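/- **Corollary 3.4.** Let $A\in\mathbb R^{m\times n}$ have columns $a_1,\dots,a_n$ and satisfy $\operatorname{rank}(A)=m<n$, and let $k\ge 0$ be an integer. For $y\in\mathbb R^m$ and $\tau\ge 0$ consider the standard Dantzig selector $$\min_x\{\|x\|_1:\ \|A^T(Ax-y)\|_\infty\le\tau\}.\qquad(\mathrm{DS})$$ *Notation.* $\|u\|_0$ is the number of nonzero entries of $u$; $u$ is $k$-sparse if $\|u\|_0\le k$. Put $\sigma_k(x)_1=\inf\{\|x-u\|_1:\|u\|_0\le k\}$, $(a)^+=\max\{a,0\}$, $\overline S=\{1,\dots,n\}\setminus S$, and $\|Q\|_{\infty\to1}=\max_{\|x\|_\infty\le1}\|Qx\|_1$. Let $$c_A=\max\{\|A_G^{-1}(AA^T)^{-1}A\|_{\infty\to1}:\ G\subseteq\{1,\dots,n\},\ |G|=m,\ A_G\text{ invertible}\},$$ where $A_G$ is the $m\times m$ submatrix of the columns of $A$ with index in $G$. For matrices $M',M''$ with the same number of columns let $$\mu_{\infty,2}(M',M'')=\max_{(d',d'')\in\mathcal F,\ \|(d',d'')\|_2\le1}\ \min_u\{\|u\|_\infty:\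 M'u\le d',\ M''u=d''\},$$ where $\mathcal F$ is the set of $(d',d'')$ for which $M'u\le d'$, $M''u=d''$ has a solution $u$. For matrices $M^1,M^2$ with $m_1,m_2$ rows and the same number of columns, Robinson's constant is $$\sigma_{\infty,2}(M^1,M^2)=\max_{S\subseteq\{1,\dots,m_1\}}\mu_{\infty,2}\left(\begin{bmatrix}I_S&0\\-I&0\end{bmatrix},\begin{bmatrix}M^1\\M^2\end{bmatrix}^T\right),$$ where $I$ is the $m_1\times m_1$ identity matrix, $I_S$ consists of its rows with index in $S$, and the zero blocks have $m_2$ columns. Let $\gamma=\gamma(A,y,\tau)=\sigma_{\infty,2}(M^1,M^2)$, where $M^1$ and $M^2$ are the coefficient matrices of, respectively, the following inequalities and equations in $z=(x,t,\xi,v,w^{(1)},\dots,w^{(7)})$, with $x,t,w^{(1)},w^{(2)}\in\mathbb R^n$, $\xi,w^{(3)}\in\mathbb R$, $v,w^{(4)},\dots,w^{(7)}\in\mathbb R^n$ and $\mathbf e\in\mathbb R^n$ the vector of ones (one row of $M^1$ per scalar inequality): - inequalities ($M^1z\le d^1$): $x-t\le0$; $-x-t\le0$; $\xi\le\tau$;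 $A^TAx-\xi\mathbf e\le A^Ty$; $-A^TAx-\xi\mathbf e\le-A^Ty$; $A^TAx-v\le A^Ty$; $-A^TAx-v\le-A^Ty$; $w^{(1)}+w^{(2)}\le\mathbf e$; $-w^{(3)}+\mathbf e^Tw^{(4)}+\mathbf e^Tw^{(5)}\le0$; $w^{(6)}+w^{(7)}\le0$; $-w^{(i)}\le0$ for $i=1,\dots,7$; - equations ($M^2z=0$): $-w^{(1)}+w^{(2)}+A^TA(w^{(4)}-w^{(5)}-w^{(6)}+w^{(7)})=0$; $\mathbf e^Tt+\tau w^{(3)}-y^TA(w^{(4)}-w^{(5)}-w^{(6)}+w^{(7)})=0$. $A^T$ satisfies the *weak RSP of order $k$* if for all disjoint $S_1,S_2\subseteq\{1,\dots,n\}$ with $|S_1|+|S_2|\le k$ there is $\zeta$ in the range of $A^T$ with $\zeta_i=1$ for $i\in S_1$, $\zeta_i=-1$ for $i\in S_2$ and $|\zeta_i|\le1$ for $i\notin S_1\cup S_2$; it satisfies the *RSP of order $k$* if this holds with $|\zeta_i|<1$ for $i\notin S_1\cup S_2$. Consider, for a feasible $x$ and an optimal solution $x^*$ of (DS), the estimate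 $$\|x-x^*\|_2\le\gamma\{2\sigma_k(x)_1+c_A\tau+c_A\|A^T(Ax-y)\|_\infty\}\le2\gamma\{\sigma_k(x)_1+c_A\tau\}.\qquad(\mathrm E)$$ **(i)** Suppose that $A^T$ satisfies the weak RSP of order $k$. Then for all $y\in\mathbb R^m$, $\tau\ge0$ and $x\in\mathbb R^n$ there is an optimal solution $x^*$ of (DS) with $$\|x-x^*\|_2\le\gamma\{(\|A^T(Ax-y)\|_\infty-\tau)^++2\sigma_k(x)_1+c_A\tau+c_A\|A^T(Ax-y)\|_\infty\};$$ in particular, for every $x$ with $\|A^T(Ax-y)\|_\infty\le\tau$ there is an optimal solution $x^*$ of (DS) satisfying (E). Conversely, suppose that for every $y\in\mathbb R^m$ there is $\tau_0>0$ such that for all $\tau\in[0,\tau_0]$ and all $x$ with $\|A^T(Ax-y)\|_\infty\le\tau$ there is an optimal solution $x^*$ of (DS) satisfying (E). Then $A^T$ satisfies the weak RSP of order $k$. **(ii)** Each of the following conditions is sufficient to ensure that, for all $y\in\mathbb R^m$, $\tau\ge0$ and all $x$ with $\|A^T(Ax-y)\|_\infty\le\tau$, there is an optimal solution $x^*$ of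 (DS) satisfying (E): - (a) mutual coherence: the columns of $A$ are $\ell_2$-normalized and $\mu_1(k)+\mu_1(k-1)<1$, where $\mu_1(s)=\max\{\sum_{j\in S}|a_i^Ta_j|:\ 1\le i\le n,\ S\subseteq\{1,\dots,n\}\setminus\{i\},\ |S|\le s\}$ (and $\mu_1(-1)=0$); - (b) RIP of order $2k$ with constant $\delta_{2k}<1/\sqrt2$: for some $\delta\in(0,1/\sqrt2)$, $(1-\delta)\|x\|_2^2\le\|Ax\|_2^2\le(1+\delta)\|x\|_2^2$ for all $2k$-sparse $x\in\mathbb R^n$; - (c) stable NSP of order $k$: for some $\rho\in(0,1)$, $\|\zeta_S\|_1\le\rho\|\zeta_{\overline S}\|_1$ for all $\zeta$ with $A\zeta=0$ and all $S$ with $|S|\le k$; - (d) robust NSP of order $k$: for some $\rho'\in(0,1)$ and $\rho''>0$, $\|\zeta_S\|_1\le\rho'\|\zeta_{\overline S}\|_1+\rho''\|A\zeta\|_2$ for all $\zeta\in\mathbb R^n$ and all $S$ with $|S|\le k$; - (e) NSP of order $k$: $\|\zeta_S\|_1<\|\zeta_{\overline S}\|_1$ for all $\zeta\ne0$ with $A\zeta=0$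 and all $S$ with $|S|\le k$; - (f) RSP of order $k$ of $A^T$. -/

import Mathlib

open scoped Matrix ENNReal

noncomputable section

namespace Dantzig

/-! ### Norms and sparsity -/

/-- The `ℓ_p`-norm of a real vector, `p ∈ [1, ∞]`. -/
def lpN {ι : Type*} [Fintype ι] (p : ℝ≥0∞) (v : ι → ℝ) : ℝ :=
  ‖WithLp.toLp p v‖

/-- The induced norm `‖Q‖_{p → q} = max {‖Q x‖_q : ‖x‖_p ≤ 1}`. -/
def inducedNorm {ι κ : Type*} [Fintype ι] [Fintype κ] (p q : ℝ≥0∞) (Q : Matrix ι κ ℝ) : ℝ :=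
  sSup {c | ∃ x : κ → ℝ, lpN p x ≤ 1 ∧ c = lpN q (Q *ᵥ x)}

/-- The error `σ_k(x)_1` of the best `k`-term approximation of `x` in the `ℓ_1`-norm;
`hammingNorm u` is the number of nonzero entries of `u`. -/
def bestTermError {n : ℕ} (k : ℕ) (x : Fin n → ℝ) : ℝ :=
  sInf {r | ∃ u : Fin n → ℝ, hammingNorm u ≤ k ∧ r = lpN 1 (x - u)}

/-! ### Robinson's constant -/

/-- `μ_{α₁,α₂}(M', M'')`: the maximum over right-hand sides `(d', d'')` with
`‖(d', d'')‖_{α₂} ≤ 1`, for which the system `M' u ≤ d', M'' u = d''` is solvable, of the least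
`ℓ_{α₁}`-norm of a solution. -/
def robinsonMu {p₁ p₂ κ : Type*} [Fintype p₁] [Fintype p₂] [Fintype κ] (α₁ α₂ : ℝ≥0∞)
    (M' : Matrix p₁ κ ℝ) (M'' : Matrix p₂ κ ℝ) : ℝ :=
  sSup {c | ∃ (d' : p₁ → ℝ) (d'' : p₂ → ℝ),
    (∃ u : κ → ℝ, M' *ᵥ u ≤ d' ∧ M'' *ᵥ u = d'') ∧
    lpN α₂ (Sum.elim d' d'') ≤ 1 ∧
    c = sInf {r | ∃ u : κ → ℝ, M' *ᵥ u ≤ d' ∧ M'' *ᵥ u = d'' ∧ r = lpN α₁ u}}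

/-- Robinson's constant
`σ_{α₁,α₂}(M¹, M²) = max_S μ_{α₁,α₂}([[I_S, 0], [-I, 0]], [M¹; M²]ᵀ)`,
`S` ranging over the sets of row indices of `M¹`; `I_S` consists of the rows of the identity
matrix with index in `S`. -/
def robinsonSigma {r₁ r₂ l : Type*} [Fintype r₁] [Fintype r₂] [Fintype l] [DecidableEq r₁]
    (α₁ α₂ : ℝ≥0∞) (M₁ : Matrix r₁ l ℝ) (M₂ : Matrix r₂ l ℝ) : ℝ :=
  ⨆ S : Finset r₁, robinsonMu α₁ α₂
    (Matrix.fromRows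
      (Matrix.fromCols ((1 : Matrix r₁ r₁ ℝ).submatrix (fun i : S => (i : r₁)) id)
        (0 : Matrix S r₂ ℝ))
      (Matrix.fromCols (-1 : Matrix r₁ r₁ ℝ) (0 : Matrix r₁ r₂ ℝ)))
    (Matrix.fromRows M₁ M₂)ᵀ

/-! ### The linear system of the primal-dual optimality conditions

The columns are indexed by the entries of `(x, t, ξ, v, w⁽¹⁾, …, w⁽⁷⁾)`. -/

/-- Index type of the variables `(x, t, ξ, v, w⁽¹⁾, …, w⁽⁷⁾)`. -/
abbrev KKTVar (n q : ℕ) : Type :=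
  Fin n ⊕ Fin n ⊕ Unit ⊕ Fin q ⊕ Fin n ⊕ Fin n ⊕ Unit ⊕ Fin q ⊕ Fin q ⊕ Fin q ⊕ Fin q

/-- Index type of the rows of the inequality block of the system. -/
abbrev KKTIneq (n q : ℕ) : Type :=
  Fin n ⊕ Fin n ⊕ Unit ⊕ Fin q ⊕ Fin q ⊕ Fin q ⊕ Fin q ⊕ Fin n ⊕ Unit ⊕ Fin q ⊕
    Fin n ⊕ Fin n ⊕ Unit ⊕ Fin q ⊕ Fin q ⊕ Fin q ⊕ Fin q

/-- Index type of the rows of the equality block of the system. -/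
abbrev KKTEq (n : ℕ) : Type := Fin n ⊕ Unit

/-- A row of eleven blocks, one for each of `x, t, ξ, v, w⁽¹⁾, …, w⁽⁷⁾`. -/
def blockRow {ρ : Type} {n q : ℕ}
    (x t : Matrix ρ (Fin n) ℝ) (xi : Matrix ρ Unit ℝ) (v : Matrix ρ (Fin q) ℝ)
    (w1 w2 : Matrix ρ (Fin n) ℝ) (w3 : Matrix ρ Unit ℝ)
    (w4 w5 w6 w7 : Matrix ρ (Fin q) ℝ) : Matrix ρ (KKTVar n q) ℝ :=
  .fromCols x (.fromCols t (.fromCols xi (.fromCols v (.fromCols w1 (.fromCols w2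
    (.fromCols w3 (.fromCols w4 (.fromCols w5 (.fromCols w6 w7)))))))))

/-- The all-ones matrix; `ones Unit ι` is the row `𝐞ᵀ` and `ones ι Unit` the column `𝐞`. -/
def ones (ρ κ : Type) : Matrix ρ κ ℝ := Matrix.of fun _ _ => 1

/-- The matrix `M¹` of the inequalities. -/
def kktM₁ {m n q : ℕ} (A : Matrix (Fin m) (Fin n) ℝ) (M : Matrix (Fin m) (Fin q) ℝ) (α : ℝ) :
    Matrix (KKTIneq n q) (KKTVar n q) ℝ :=
  .fromRows (blockRow 1 (-1) 0 0 0 0 0 0 0 0 0) <|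
  .fromRows (blockRow (-1) (-1) 0 0 0 0 0 0 0 0 0) <|
  .fromRows (blockRow 0 0 (α • ones Unit Unit) ((1 - α) • ones Unit (Fin q)) 0 0 0 0 0 0 0) <|
  .fromRows (blockRow (Mᵀ * A) 0 (-ones (Fin q) Unit) 0 0 0 0 0 0 0 0) <|
  .fromRows (blockRow (-(Mᵀ * A)) 0 (-ones (Fin q) Unit) 0 0 0 0 0 0 0 0) <|
  .fromRows (blockRow (Mᵀ * A) 0 0 (-1) 0 0 0 0 0 0 0) <|
  .fromRows (blockRow (-(Mᵀ * A)) 0 0 (-1) 0 0 0 0 0 0 0) <|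
  .fromRows (blockRow 0 0 0 0 1 1 0 0 0 0 0) <|
  .fromRows (blockRow 0 0 0 0 0 0 (-α • ones Unit Unit) (ones Unit (Fin q)) (ones Unit (Fin q))
    0 0) <|
  .fromRows (blockRow 0 0 0 0 0 0 (-(1 - α) • ones (Fin q) Unit) 0 0 1 1) <|
  .fromRows (blockRow 0 0 0 0 (-1) 0 0 0 0 0 0) <|
  .fromRows (blockRow 0 0 0 0 0 (-1) 0 0 0 0 0) <|
  .fromRows (blockRow 0 0 0 0 0 0 (-1) 0 0 0 0) <|
  .fromRows (blockRow 0 0 0 0 0 0 0 (-1) 0 0 0) <|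
  .fromRows (blockRow 0 0 0 0 0 0 0 0 (-1) 0 0) <|
  .fromRows (blockRow 0 0 0 0 0 0 0 0 0 (-1) 0)
    (blockRow 0 0 0 0 0 0 0 0 0 0 (-1))

/-- The row `yᵀM`. -/
def yTM {m q : ℕ} (M : Matrix (Fin m) (Fin q) ℝ) (y : Fin m → ℝ) : Matrix Unit (Fin q) ℝ :=
  Matrix.replicateRow Unit (y ᵥ* M)

/-- The matrix `M²` of the equations. -/
def kktM₂ {m n q : ℕ} (A : Matrix (Fin m) (Fin n) ℝ) (M : Matrix (Fin m) (Fin q) ℝ)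
    (y : Fin m → ℝ) (τ : ℝ) : Matrix (KKTEq n) (KKTVar n q) ℝ :=
  .fromRows
    (blockRow 0 0 0 0 (-1) 1 0 (Aᵀ * M) (-(Aᵀ * M)) (-(Aᵀ * M)) (Aᵀ * M))
    (blockRow 0 (ones Unit (Fin n)) 0 0 0 0 (τ • ones Unit Unit)
      (-yTM M y) (yTM M y) (yTM M y) (-yTM M y))

/-! ### The standard Dantzig selector -/

/-- The residual size `‖Aᵀ(Ax - y)‖_∞`. -/
def dsResidual {m n : ℕ} (A : Matrix (Fin m) (Fin n) ℝ) (y : Fin m → ℝ) (x : Fin n → ℝ) : ℝ :=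
  lpN ∞ (Aᵀ *ᵥ (A *ᵥ x - y))

/-- `x'` is an optimal solution of `min {‖x‖_1 : ‖Aᵀ(Ax - y)‖_∞ ≤ τ}`. -/
def IsOptimal {m n : ℕ} (A : Matrix (Fin m) (Fin n) ℝ) (y : Fin m → ℝ) (τ : ℝ)
    (x' : Fin n → ℝ) : Prop :=
  dsResidual A y x' ≤ τ ∧ ∀ z : Fin n → ℝ, dsResidual A y z ≤ τ → lpN 1 x' ≤ lpN 1 z

/-- Robinson's constant `γ = σ_{∞,2}(M¹, M²)` for the standard Dantzig selector
(`M = A` and `α = 1`). -/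
def gammaDS {m n : ℕ} (A : Matrix (Fin m) (Fin n) ℝ) (y : Fin m → ℝ) (τ : ℝ) : ℝ :=
  robinsonSigma ∞ 2 (kktM₁ A A 1) (kktM₂ A A y τ)

/-- `c_A`: the maximum of `‖A_G⁻¹ (A Aᵀ)⁻¹ A‖_{∞ → 1}` over the sets `G` of `m` columns for which
the square submatrix `A_G` is invertible. -/
def cA {m n : ℕ} (A : Matrix (Fin m) (Fin n) ℝ) : ℝ :=
  sSup {c | ∃ (G : Finset (Fin n)) (hG : G.card = m),
    IsUnit (A.submatrix id (G.orderEmbOfFin hG)) ∧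
    c = inducedNorm ∞ 1 ((A.submatrix id (G.orderEmbOfFin hG))⁻¹ * (A * Aᵀ)⁻¹ * A)}

/-- The two-step error estimate
`‖x - x'‖₂ ≤ γ {2σ_k(x)_1 + c_A τ + c_A ‖Aᵀ(Ax - y)‖_∞} ≤ 2γ {σ_k(x)_1 + c_A τ}`. -/
def ErrorEstimate {m n : ℕ} (A : Matrix (Fin m) (Fin n) ℝ) (k : ℕ) (y : Fin m → ℝ) (τ : ℝ)
    (x x' : Fin n → ℝ) : Prop :=
  lpN 2 (x - x') ≤
      gammaDS A y τ * (2 * bestTermError k x + cA A * τ + cA A * dsResidual A y x) ∧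
  gammaDS A y τ * (2 * bestTermError k x + cA A * τ + cA A * dsResidual A y x) ≤
      2 * gammaDS A y τ * (bestTermError k x + cA A * τ)

/-! ### Matrix conditions -/

/-- The weak range space property of order `k` of `Aᵀ`. -/
def WeakRSP {m n : ℕ} (A : Matrix (Fin m) (Fin n) ℝ) (k : ℕ) : Prop :=
  ∀ S₁ S₂ : Finset (Fin n), Disjoint S₁ S₂ → S₁.card + S₂.card ≤ k →
    ∃ u : Fin m → ℝ, (∀ i ∈ S₁, (Aᵀ *ᵥ u) i = 1) ∧ (∀ i ∈ S₂, (Aᵀ *ᵥ u) i = -1) ∧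
      ∀ i, i ∉ S₁ ∪ S₂ → |(Aᵀ *ᵥ u) i| ≤ 1

/-- The range space property of order `k` of `Aᵀ`. -/
def RSP {m n : ℕ} (A : Matrix (Fin m) (Fin n) ℝ) (k : ℕ) : Prop :=
  ∀ S₁ S₂ : Finset (Fin n), Disjoint S₁ S₂ → S₁.card + S₂.card ≤ k →
    ∃ u : Fin m → ℝ, (∀ i ∈ S₁, (Aᵀ *ᵥ u) i = 1) ∧ (∀ i ∈ S₂, (Aᵀ *ᵥ u) i = -1) ∧
      ∀ i, i ∉ S₁ ∪ S₂ → |(Aᵀ *ᵥ u) i| < 1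

/-- The null space property of order `k`. -/
def NSP {m n : ℕ} (A : Matrix (Fin m) (Fin n) ℝ) (k : ℕ) : Prop :=
  ∀ z : Fin n → ℝ, z ≠ 0 → A *ᵥ z = 0 → ∀ S : Finset (Fin n), S.card ≤ k →
    ∑ i ∈ S, |z i| < ∑ i ∈ Sᶜ, |z i|

/-- The stable null space property of order `k` with constant `ρ`. -/
def StableNSP {m n : ℕ} (A : Matrix (Fin m) (Fin n) ℝ) (k : ℕ) (ρ : ℝ) : Prop :=
  ∀ z : Fin n → ℝ, A *ᵥ z = 0 → ∀ S : Finset (Fin n), S.card ≤ k →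
    ∑ i ∈ S, |z i| ≤ ρ * ∑ i ∈ Sᶜ, |z i|

/-- The robust null space property of order `k` with constants `ρ'` and `ρ''`; as usual, the
inequality is required for all vectors (on the null space it is the stable property). -/
def RobustNSP {m n : ℕ} (A : Matrix (Fin m) (Fin n) ℝ) (k : ℕ) (ρ' ρ'' : ℝ) : Prop :=
  ∀ z : Fin n → ℝ, ∀ S : Finset (Fin n), S.card ≤ k →
    ∑ i ∈ S, |z i| ≤ ρ' * ∑ i ∈ Sᶜ, |z i| + ρ'' * lpN 2 (A *ᵥ z)

/-- The restricted isometry property of order `k` with constant `δ`. -/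
def RIP {m n : ℕ} (A : Matrix (Fin m) (Fin n) ℝ) (k : ℕ) (δ : ℝ) : Prop :=
  ∀ x : Fin n → ℝ, hammingNorm x ≤ k →
    (1 - δ) * lpN 2 x ^ 2 ≤ lpN 2 (A *ᵥ x) ^ 2 ∧ lpN 2 (A *ᵥ x) ^ 2 ≤ (1 + δ) * lpN 2 x ^ 2

/-- The `ℓ_1`-coherence function
`μ_1(s) = max {∑_{j ∈ S} |⟨a_i, a_j⟩| : |S| ≤ s, i ∉ S}`, `a_j` being the columns of `A`. For
`s ≤ n - 1` it makes no difference whether `|S| ≤ s` or `|S| = s` is required. -/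
def coherence {m n : ℕ} (A : Matrix (Fin m) (Fin n) ℝ) (s : ℕ) : ℝ :=
  sSup {c | ∃ (i : Fin n) (S : Finset (Fin n)), i ∉ S ∧ S.card ≤ s ∧
    c = ∑ j ∈ S, |A.col i ⬝ᵥ A.col j|}

/-- The mutual coherence condition: the columns are `ℓ_2`-normalized and
`μ_1(k) + μ_1(k - 1) < 1`. -/
def CoherenceCondition {m n : ℕ} (A : Matrix (Fin m) (Fin n) ℝ) (k : ℕ) : Prop :=
  (∀ j, lpN 2 (A.col j) = 1) ∧ coherence A k + coherence A (k - 1) < 1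

end Dantzig

end

namespace Dantzig

/-! The optimal solutions of (DS) are exactly the `x`-parts of the solutions of a linear system:
primal feasibility, dual feasibility and vanishing duality gap. Robinson's bound
(`exists_dist_le_robinsonSigma`) says that any point `z` lies within `γ` times its total constraint
violation of a solvable system's solution set. So it suffices to complete a given `x` to a point `z`
that nearly satisfies the system.

The weak RSP supplies this completion. It gives `ζ = Aᵀu` with `‖ζ‖_∞ ≤ 1` that agrees with the
signs of `x` on a best `k`-term support, so `‖x‖₁ - x·ζ ≤ 2σ_k(x)₁` (`WeakRSP.exists_dual`). A
preimage `g` of `u` under `A` with `‖g‖₁ ≤ c_A` serves as dual variable. Then only two rows can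
fail: `ξ ≤ τ`, by `(r - τ)⁺` with `r = ‖Aᵀ(Ax - y)‖_∞`, and the duality gap, by at most `2σ_k(x)₁ +
c_A τ + c_A r`.

Conversely, for `τ = 0`, `y = As` and a sign vector `s` with at most `k` nonzero entries, the right
side of the estimate is zero, so `s` is itself optimal. Its dual certificate must equal `±1` on the
support of `s` by complementary slackness, which is the weak RSP (`weakRSP_of_isOptimal`).

For (ii), each condition except the RSP implies the non-strict null space property `‖z_S‖₁ ≤
‖z_Sᶜ‖₁` on the kernel. This makes every such `s` an `ℓ₁`-minimizer, and the same duality argument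
gives the weak RSP. The hard case is the RIP below `1/√2` (`RIP.sum_le`). -/

theorem mulVec_eq_sum_col {ι κ : Type*} [Fintype κ] (N : Matrix ι κ ℝ) (u : κ → ℝ) : N *ᵥ u = ∑ j, u j • N.col j := by
  ext i
  simp [Matrix.mulVec, dotProduct, mul_comm]

/-! ### Finitely generated cones and Farkas' lemma -/

section Cones

variable {ι κ : Type*} [Fintype ι] [Fintype κ]

/-- Carathéodory's theorem for finitely generated cones. -/
theorem exists_nonneg_linearIndepOn {E : Type*} [AddCommGroup E] [Module ℝ E] (v : κ → E)
    (u : κ → ℝ) (hu : 0 ≤ u) :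
    ∃ u' : κ → ℝ, 0 ≤ u' ∧ ∑ j, u' j • v j = ∑ j, u j • v j ∧
      LinearIndepOn ℝ v {j | u' j ≠ 0} := by
  classical
  induction h : hammingNorm u using Nat.strong_induction_on generalizing u with
  | _ N ih =>
  by_cases hli : LinearIndepOn ℝ v {j | u j ≠ 0}
  · exact ⟨u, hu, rfl, hli⟩
  obtain ⟨g, hgs, hg0, j₀, hj₀⟩ : ∃ g : κ → ℝ, (∀ j, u j = 0 → g j = 0) ∧ ∑ j, g j • v j = 0 ∧
      ∃ j, 0 < g j := by
    obtain ⟨g, hgs, hg0, hne⟩ : ∃ g : κ → ℝ, (∀ j, u j = 0 → g j = 0) ∧ ∑ j, g j • v j = 0 ∧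
        g ≠ 0 := by
      rw [LinearIndepOn, Fintype.not_linearIndependent_iff] at hli
      obtain ⟨g, hg, ⟨i, hi⟩, hgi⟩ := hli
      refine ⟨fun j => if hj : u j ≠ 0 then g ⟨j, hj⟩ else 0, fun j hj => by simp [hj], ?_, ?_⟩
      · rw [← hg, ← Finset.sum_filter_of_ne (p := fun j => u j ≠ 0),
          Finset.sum_subtype (p := fun j => u j ≠ 0) _ (by simp)]
        · exact Finset.sum_congr rfl fun j _ => by simp [j.2]
        · intro j _ hj h0
          simp [h0] at hj
      · intro h0
        have := congrFun h0 i
        simp only [Set.mem_ofPred_eq] at hi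
        simp [hi] at this
        exact hgi this
    by_cases hp : ∃ j, 0 < g j
    · exact ⟨g, hgs, hg0, hp⟩
    · push Not at hp
      obtain ⟨j, hj⟩ := Function.ne_iff.1 hne
      refine ⟨-g, fun j hj => by simp [hgs j hj], by simp [hg0], j, ?_⟩
      have := lt_of_le_of_ne (hp j) hj
      simpa using this
  -- Ratio test: the smallest quotient `u j / g j` is the largest multiple of `g` that can be
  -- subtracted from `u` with all entries staying nonnegative, and it cancels entry `j₁`.
  obtain ⟨j₁, hj₁, hmin⟩ := Finset.exists_min_image (Finset.univ.filter fun j => 0 < g j)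
    (fun j => u j / g j) ⟨j₀, by simp [hj₀]⟩
  simp only [Finset.mem_filter, Finset.mem_univ, true_and] at hj₁ hmin
  set t := u j₁ / g j₁ with ht
  have ht0 : 0 ≤ t := div_nonneg (hu j₁) hj₁.le
  have hu1 : u j₁ ≠ 0 := fun h0 => hj₁.ne' (hgs _ h0)
  have hlt : hammingNorm (u - t • g) < N := by
    rw [← h]
    apply Finset.card_lt_card
    rw [Finset.ssubset_iff_of_subset]
    · refine ⟨j₁, by simp [hu1], ?_⟩
      simp [ht, div_mul_cancel₀ _ hj₁.ne']
    · intro j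
      simp only [Finset.mem_filter, Finset.mem_univ, true_and]
      intro hj h0
      exact hj (by simp [h0, hgs j h0])
  have hnn : 0 ≤ u - t • g := by
    intro j
    simp only [Pi.zero_apply, Pi.sub_apply, Pi.smul_apply, smul_eq_mul, sub_nonneg]
    rcases lt_or_ge 0 (g j) with hj | hj
    · exact (le_div_iff₀ hj).1 (hmin j hj)
    · exact (mul_nonpos_of_nonneg_of_nonpos ht0 hj).trans (hu j)
  obtain ⟨u', h1, h2, h3⟩ := ih _ hlt (u - t • g) hnn rfl
  refine ⟨u', h1, ?_, h3⟩
  rw [h2]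
  simp only [Pi.sub_apply, Pi.smul_apply, smul_eq_mul, sub_smul, mul_smul, Finset.sum_sub_distrib,
    ← Finset.smul_sum, hg0, smul_zero, sub_zero]

/-- Solvable systems `N u = d`, `u ≥ 0` have solutions bounded by a multiple of `‖d‖`. -/
theorem exists_bound_nonneg_solution (N : Matrix ι κ ℝ) :
    ∃ C : ℝ, 0 ≤ C ∧ ∀ u : κ → ℝ, 0 ≤ u →
      ∃ u' : κ → ℝ, 0 ≤ u' ∧ N *ᵥ u' = N *ᵥ u ∧ ‖u'‖ ≤ C * ‖N *ᵥ u‖ := by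
  classical
  -- On vectors supported by an independent set of columns, `N` is injective, hence bounded below.
  -- There are finitely many column sets, so the sum of the constants serves all of them; dependent
  -- sets contribute 0.
  have key : ∀ J : Set κ, ∃ C : ℝ, 0 ≤ C ∧ (LinearIndepOn ℝ N.col J →
      ∀ c : κ → ℝ, (∀ j, j ∉ J → c j = 0) → ‖c‖ ≤ C * ‖N *ᵥ c‖) := by
    intro J
    by_cases hJ : LinearIndepOn ℝ N.col J
    · have hker : LinearMap.ker (Fintype.linearCombination ℝ (fun j : J => N.col j)) = ⊥ := by
        rw [LinearMap.ker_eq_bot]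
        exact linearIndependent_iff_injective_fintypeLinearCombination.1 hJ
      obtain ⟨K, -, hK⟩ := LinearMap.exists_antilipschitzWith _ hker
      refine ⟨K, K.2, fun _ c hc => ?_⟩
      have h1 := hK.le_mul_dist (fun j : J => c j) 0
      simp only [map_zero, dist_zero_right] at h1
      have h2 : Fintype.linearCombination ℝ (fun j : J => N.col j) (fun j : J => c j) = N *ᵥ c := by
        rw [Fintype.linearCombination_apply, mulVec_eq_sum_col]
        rw [← Finset.sum_filter_of_ne (s := Finset.univ) (p := fun j => j ∈ J),
          Finset.sum_subtype (p := fun j => j ∈ J) _ (by simp)]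
        intro j _ hj
        by_contra h0
        simp [hc j h0] at hj
      rw [h2] at h1
      refine le_trans ?_ h1
      rw [pi_norm_le_iff_of_nonneg (norm_nonneg _)]
      intro j
      by_cases hj : j ∈ J
      · exact norm_le_pi_norm (fun j : J => c j) ⟨j, hj⟩
      · simp [hc j hj]
    · exact ⟨0, le_rfl, fun h => absurd h hJ⟩
  choose C hC0 hC using key
  refine ⟨∑ J : Finset κ, C J, Finset.sum_nonneg fun J _ => hC0 _, fun u hu => ?_⟩
  obtain ⟨u', h1, h2, h3⟩ := exists_nonneg_linearIndepOn N.col u hu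
  have h4 : N *ᵥ u' = N *ᵥ u := by
    rw [mulVec_eq_sum_col, mulVec_eq_sum_col]
    exact h2
  refine ⟨u', h1, h4, ?_⟩
  rw [← h4]
  have h5 := hC _ h3 u' (fun j hj => by simpa using hj)
  refine h5.trans (mul_le_mul_of_nonneg_right ?_ (norm_nonneg _))
  have h6 := Finset.single_le_sum (f := fun J : Finset κ => C J) (fun J _ => hC0 J)
    (Finset.mem_univ (Finset.univ.filter fun j => u' j ≠ 0))
  simpa using h6

/-- A convergent sequence in the cone has bounded coefficient vectors, by
`exists_bound_nonneg_solution`; a limit point of these represents the limit. Closedness is what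
permits separation in Farkas' lemma. -/
theorem isClosed_cone (N : Matrix ι κ ℝ) : IsClosed {d | ∃ u : κ → ℝ, 0 ≤ u ∧ N *ᵥ u = d} := by
  obtain ⟨C, hC0, hC⟩ := exists_bound_nonneg_solution N
  rw [← isSeqClosed_iff_isClosed]
  intro d d₀ hd hlim
  obtain ⟨R, hR⟩ := hlim.norm.bddAbove_range
  choose u hu hud using hd
  choose u' h1 h2 h3 using fun i => hC (u i) (hu i)
  have hmem : ∀ i, u' i ∈ Metric.closedBall (0 : κ → ℝ) (C * R) := by
    intro i
    rw [mem_closedBall_zero_iff]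
    refine (h3 i).trans (mul_le_mul_of_nonneg_left ?_ hC0)
    rw [hud]
    exact hR ⟨i, rfl⟩
  obtain ⟨a, -, φ, hφ, ha⟩ := (isCompact_closedBall (0 : κ → ℝ) (C * R)).tendsto_subseq hmem
  refine ⟨a, ge_of_tendsto' ha fun i => h1 _, ?_⟩
  have hc : Continuous fun u : κ → ℝ => N *ᵥ u := by fun_prop
  refine tendsto_nhds_unique ((hc.tendsto a).comp ha) ?_
  refine (hlim.comp hφ.tendsto_atTop).congr fun i => ?_
  simp [h2, hud]

/-- Farkas' lemma. -/
theorem farkas (N : Matrix ι κ ℝ) (d : ι → ℝ)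
    (h : ∀ y : ι → ℝ, 0 ≤ y ᵥ* N → 0 ≤ y ⬝ᵥ d) : ∃ u : κ → ℝ, 0 ≤ u ∧ N *ᵥ u = d := by
  classical
  let K : ProperCone ℝ (ι → ℝ) :=
    { carrier := {d | ∃ u : κ → ℝ, 0 ≤ u ∧ N *ᵥ u = d}
      add_mem' := by
        rintro _ _ ⟨u, hu, rfl⟩ ⟨w, hw, rfl⟩
        exact ⟨u + w, add_nonneg hu hw, Matrix.mulVec_add _ _ _⟩
      zero_mem' := ⟨0, le_rfl, by simp⟩
      smul_mem' := by
        rintro ⟨c, hc⟩ _ ⟨u, hu, rfl⟩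
        exact ⟨c • u, smul_nonneg hc hu, Matrix.mulVec_smul _ _ _⟩
      isClosed' := isClosed_cone N }
  by_contra hd
  obtain ⟨f, hf, hfd⟩ := K.hyperplane_separation_point (x₀ := d) hd
  have hfy : ∀ x, f x = (fun i => f (Pi.single i 1)) ⬝ᵥ x := by
    intro x
    conv_lhs => rw [pi_eq_sum_univ' x]
    simp [dotProduct, mul_comm]
  have := h (fun i => f (Pi.single i 1)) (fun j => ?_)
  · rw [← hfy] at this
    exact absurd hfd (not_lt.2 this)
  · have h1 := hf (N *ᵥ Pi.single j 1) ⟨Pi.single j 1, by simp, rfl⟩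
    rw [hfy, Matrix.dotProduct_mulVec] at h1
    simpa using h1

/-- The affine form of Farkas' lemma: the inequalities valid on a nonempty polyhedron. -/
theorem exists_multiplier (B : Matrix ι κ ℝ) (b : ι → ℝ) (c : κ → ℝ) (δ : ℝ) (x₀ : κ → ℝ)
    (hx₀ : B *ᵥ x₀ ≤ b) (h : ∀ x, B *ᵥ x ≤ b → c ⬝ᵥ x ≤ δ) :
    ∃ l : ι → ℝ, 0 ≤ l ∧ l ᵥ* B = c ∧ l ⬝ᵥ b ≤ δ := by
  -- The extra column is a slack variable that turns `l ⬝ᵥ b ≤ δ` into an equation.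
  let N : Matrix (κ ⊕ Unit) (ι ⊕ Unit) ℝ :=
    Matrix.fromBlocks Bᵀ 0 (Matrix.replicateRow Unit b) 1
  suffices hN : ∀ y : κ ⊕ Unit → ℝ, 0 ≤ y ᵥ* N → 0 ≤ y ⬝ᵥ (Sum.elim c fun _ => δ) by
    obtain ⟨u, hu, hNu⟩ := farkas N (Sum.elim c fun _ => δ) hN
    refine ⟨u ∘ Sum.inl, fun i => hu _, ?_, ?_⟩
    · have := congrArg (fun w => w ∘ Sum.inl) hNu
      simpa [N, Matrix.fromBlocks_mulVec, Matrix.mulVec_transpose] using this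
    · have := congrFun hNu (Sum.inr ())
      simp only [N, Matrix.fromBlocks_mulVec] at this
      simp [Matrix.mulVec] at this
      have h2 := hu (Sum.inr ())
      simp at h2
      rw [dotProduct_comm]
      linarith
  intro y hy
  have hs : 0 ≤ y (Sum.inr ()) := by
    have := hy (Sum.inr ())
    simpa [N, Matrix.vecMul_fromBlocks] using this
  have hB : 0 ≤ B *ᵥ (y ∘ Sum.inl) + y (Sum.inr ()) • b := by
    intro i
    have := hy (Sum.inl i)
    simp only [N, Matrix.vecMul_fromBlocks, Matrix.vecMul_transpose] at this
    simpa [Matrix.vecMul, dotProduct, Function.comp_def] using this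
  have goal : y ⬝ᵥ (Sum.elim c fun _ => δ) = c ⬝ᵥ (y ∘ Sum.inl) + y (Sum.inr ()) * δ := by
    simp [dotProduct, mul_comm]
  rw [goal]
  rcases hs.lt_or_eq with hs | hs
  -- For a positive last coordinate `s`, the point `-y/s` is feasible and `h` applies to it.
  · have h1 := h (-(y (Sum.inr ()))⁻¹ • (y ∘ Sum.inl)) ?_
    · rw [dotProduct_smul, smul_eq_mul, neg_mul, inv_mul_eq_div, neg_le, le_div_iff₀ hs] at h1
      linarith
    · intro i
      have := hB i
      rw [Matrix.mulVec_smul]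
      simp only [Pi.zero_apply, Pi.add_apply, Pi.smul_apply, smul_eq_mul] at this ⊢
      rw [neg_mul, inv_mul_eq_div, neg_le, le_div_iff₀ hs]
      linarith
  · rw [← hs] at hB ⊢
    simp only [zero_smul, add_zero, zero_mul] at hB ⊢
    -- For a zero last coordinate, `-y` is a recession direction; if `c` increased along it, moving
    -- far enough from `x₀` would violate `h`.
    by_contra! hneg
    obtain ⟨t, ht⟩ := exists_nat_gt ((δ - c ⬝ᵥ x₀) / (-(c ⬝ᵥ (y ∘ Sum.inl))))
    rw [div_lt_iff₀ (by linarith)] at ht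
    have h1 := h (x₀ - (t : ℝ) • (y ∘ Sum.inl)) ?_
    · rw [dotProduct_sub, dotProduct_smul, smul_eq_mul] at h1
      linarith
    · intro i
      have h2 := hB i
      have h3 := hx₀ i
      rw [Matrix.mulVec_sub, Matrix.mulVec_smul]
      simp only [Pi.zero_apply, Pi.sub_apply, Pi.smul_apply, smul_eq_mul] at h2 ⊢
      nlinarith [mul_nonneg (Nat.cast_nonneg (α := ℝ) t) h2]

end Cones

/-! ### Elementary facts about the norms -/

section Norms

variable {ι : Type*} [Fintype ι]

theorem lpN_one (v : ι → ℝ) : lpN 1 v = ∑ i, |v i| := by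
  simp [lpN, PiLp.norm_eq_of_L1]

theorem lpN_top (v : ι → ℝ) : lpN ∞ v = ‖v‖ := by
  simp [lpN]

theorem lpN_two (v : ι → ℝ) : lpN 2 v = √(∑ i, v i ^ 2) := by
  simp [lpN, EuclideanSpace.norm_eq]

theorem lpN_two_nonneg (v : ι → ℝ) : 0 ≤ lpN 2 v := norm_nonneg _

theorem lpN_two_sq (v : ι → ℝ) : lpN 2 v ^ 2 = v ⬝ᵥ v := by
  rw [lpN_two, Real.sq_sqrt (Finset.sum_nonneg fun i _ => sq_nonneg _)]
  simp [dotProduct, sq]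

theorem abs_apply_le_lpN_two (v : ι → ℝ) (i : ι) : |v i| ≤ lpN 2 v := by
  rw [lpN_two]
  refine Real.le_sqrt_of_sq_le ?_
  rw [sq_abs]
  exact Finset.single_le_sum (f := fun i => v i ^ 2) (fun i _ => sq_nonneg _) (Finset.mem_univ i)

theorem abs_apply_le_lpN_top (v : ι → ℝ) (i : ι) : |v i| ≤ lpN ∞ v := by
  rw [lpN_top]
  exact norm_le_pi_norm v i

theorem lpN_top_nonneg (v : ι → ℝ) : 0 ≤ lpN ∞ v := by
  rw [lpN_top]
  exact norm_nonneg _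

theorem lpN_top_le_iff (v : ι → ℝ) {r : ℝ} (hr : 0 ≤ r) : lpN ∞ v ≤ r ↔ ∀ i, |v i| ≤ r := by
  rw [lpN_top, pi_norm_le_iff_of_nonneg hr]
  simp only [Real.norm_eq_abs]

theorem lpN_two_eq_zero {v : ι → ℝ} (h : lpN 2 v ≤ 0) : v = 0 := by
  ext i
  exact abs_nonpos_iff.1 ((abs_apply_le_lpN_two v i).trans h)

end Norms

/-! ### Robinson's constant and the error bound -/

section Robinson

variable {p₁ p₂ κ : Type*} [Fintype p₁] [Fintype p₂] [Fintype κ]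

/-- Solvable linear systems of inequalities and equations have solutions bounded by a multiple of
the right-hand side. -/
theorem exists_bound_solution (M' : Matrix p₁ κ ℝ) (M'' : Matrix p₂ κ ℝ) :
    ∃ C : ℝ, 0 ≤ C ∧ ∀ (d' : p₁ → ℝ) (d'' : p₂ → ℝ) (u : κ → ℝ), M' *ᵥ u ≤ d' → M'' *ᵥ u = d'' →
      ∃ u' : κ → ℝ, M' *ᵥ u' ≤ d' ∧ M'' *ᵥ u' = d'' ∧ ‖u'‖ ≤ C * ‖Sum.elim d' d''‖ := by
  classical
  -- Standard form: `u` is split into positive and negative parts, and slack variables are added to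
  -- the inequalities.
  let N : Matrix (p₁ ⊕ p₂) ((κ ⊕ κ) ⊕ p₁) ℝ :=
    .fromRows (.fromCols (.fromCols M' (-M')) 1) (.fromCols (.fromCols M'' (-M'')) 0)
  have hN : ∀ w : (κ ⊕ κ) ⊕ p₁ → ℝ, N *ᵥ w = Sum.elim
      (M' *ᵥ (fun j => w (.inl (.inl j)) - w (.inl (.inr j))) + w ∘ Sum.inr)
      (M'' *ᵥ (fun j => w (.inl (.inl j)) - w (.inl (.inr j)))) := by
    intro w
    have : (fun j => w (.inl (.inl j)) - w (.inl (.inr j))) =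
      ((w ∘ Sum.inl) ∘ Sum.inl) - ((w ∘ Sum.inl) ∘ Sum.inr) := rfl
    rw [this, Matrix.mulVec_sub, Matrix.mulVec_sub]
    simp only [N, Matrix.fromRows_mulVec, Matrix.fromCols_mulVec, Matrix.neg_mulVec,
      Matrix.one_mulVec, Matrix.zero_mulVec, add_zero, sub_eq_add_neg]
  obtain ⟨C, hC0, hC⟩ := exists_bound_nonneg_solution N
  refine ⟨2 * C, by positivity, fun d' d'' u h1 h2 => ?_⟩
  have hw : N *ᵥ (Sum.elim (Sum.elim (fun j => max (u j) 0) (fun j => max (-u j) 0))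
      (d' - M' *ᵥ u)) = Sum.elim d' d'' := by
    have h3 : (fun j => max (u j) 0 - max (-u j) 0) = u :=
      funext fun j => max_zero_sub_max_neg_zero_eq_self (u j)
    rw [hN]
    simp only [Sum.elim_inl, Sum.elim_inr, h3, h2, Sum.elim_comp_inr, add_sub_cancel]
  obtain ⟨w, hw0, hNw, hwC⟩ := hC (Sum.elim
    (Sum.elim (fun j => max (u j) 0) (fun j => max (-u j) 0)) (d' - M' *ᵥ u)) (by
    rintro ((j | j) | i)
    · simp
    · simp
    · simpa using h1 i)
  rw [hw] at hNw hwC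
  rw [hN] at hNw
  refine ⟨fun j => w (.inl (.inl j)) - w (.inl (.inr j)), fun i => ?_, ?_, ?_⟩
  · have h4 := congrFun hNw (.inl i)
    have h5 := hw0 (.inr i)
    simp only [Sum.elim_inl, Pi.add_apply, Function.comp_apply, Pi.zero_apply] at h4 h5
    linarith
  · simpa using congrArg (fun f => f ∘ Sum.inr) hNw
  · rw [pi_norm_le_iff_of_nonneg (by positivity)]
    intro j
    have h6 := norm_sub_le (w (.inl (.inl j))) (w (.inl (.inr j)))
    have h7 := norm_le_pi_norm w (.inl (.inl j))
    have h8 := norm_le_pi_norm w (.inl (.inr j))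
    linarith

/-- Needed because the `sSup` of an unbounded set of reals is 0 by convention, which would make the
constant useless as an upper bound. -/
theorem bddAbove_robinsonMu (M' : Matrix p₁ κ ℝ) (M'' : Matrix p₂ κ ℝ) :
    BddAbove {c | ∃ (d' : p₁ → ℝ) (d'' : p₂ → ℝ),
      (∃ u : κ → ℝ, M' *ᵥ u ≤ d' ∧ M'' *ᵥ u = d'') ∧
      lpN 2 (Sum.elim d' d'') ≤ 1 ∧
      c = sInf {r | ∃ u : κ → ℝ, M' *ᵥ u ≤ d' ∧ M'' *ᵥ u = d'' ∧ r = lpN ∞ u}} := by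
  obtain ⟨C, hC0, hC⟩ := exists_bound_solution M' M''
  refine ⟨C, ?_⟩
  rintro _ ⟨d', d'', ⟨u, h1, h2⟩, h3, rfl⟩
  obtain ⟨u', h4, h5, h6⟩ := hC d' d'' u h1 h2
  have hb : BddBelow {r | ∃ u : κ → ℝ, M' *ᵥ u ≤ d' ∧ M'' *ᵥ u = d'' ∧ r = lpN ∞ u} := by
    refine ⟨0, ?_⟩
    rintro _ ⟨w, -, -, rfl⟩
    exact lpN_top_nonneg w
  refine (csInf_le hb ⟨u', h4, h5, rfl⟩).trans ?_
  · rw [lpN_top]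
    refine h6.trans (mul_le_of_le_one_right hC0 ?_)
    rw [pi_norm_le_iff_of_nonneg zero_le_one]
    exact fun i => (abs_apply_le_lpN_two _ i).trans h3

theorem robinsonMu_nonneg (M' : Matrix p₁ κ ℝ) (M'' : Matrix p₂ κ ℝ) :
    0 ≤ robinsonMu ∞ 2 M' M'' := by
  refine Real.sSup_nonneg ?_
  rintro _ ⟨d', d'', -, -, rfl⟩
  refine Real.sInf_nonneg ?_
  rintro _ ⟨w, -, -, rfl⟩
  exact lpN_top_nonneg w

/-- The slack `ε` makes it unnecessary to know that the least norm of a solution is attained. -/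
theorem exists_lpN_top_lt_robinsonMu_add (M' : Matrix p₁ κ ℝ) (M'' : Matrix p₂ κ ℝ) {d' : p₁ → ℝ}
    {d'' : p₂ → ℝ} {u : κ → ℝ} (h1 : M' *ᵥ u ≤ d') (h2 : M'' *ᵥ u = d'')
    (h3 : lpN 2 (Sum.elim d' d'') ≤ 1) {ε : ℝ} (hε : 0 < ε) :
    ∃ u' : κ → ℝ, M' *ᵥ u' ≤ d' ∧ M'' *ᵥ u' = d'' ∧ lpN ∞ u' < robinsonMu ∞ 2 M' M'' + ε := by
  have h4 := le_csSup (bddAbove_robinsonMu M' M'') ⟨d', d'', ⟨u, h1, h2⟩, h3, rfl⟩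
  obtain ⟨_, ⟨u', h5, h6, rfl⟩, h7⟩ := Real.lt_sInf_add_pos
    (s := {r | ∃ u : κ → ℝ, M' *ᵥ u ≤ d' ∧ M'' *ᵥ u = d'' ∧ r = lpN ∞ u}) ⟨_, u, h1, h2, rfl⟩ hε
  exact ⟨u', h5, h6, h7.trans_le (add_le_add_left h4 ε)⟩

variable {r₁ r₂ l : Type*} [Fintype r₁] [Fintype r₂] [Fintype l]

/-- The projection onto a nonempty polyhedron, with its multipliers. -/
theorem exists_projection (M₁ : Matrix r₁ l ℝ) (M₂ : Matrix r₂ l ℝ) (d₁ : r₁ → ℝ) (d₂ : r₂ → ℝ)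
    (z z₀ : l → ℝ) (h₁ : M₁ *ᵥ z₀ ≤ d₁) (h₂ : M₂ *ᵥ z₀ = d₂) :
    ∃ (p : l → ℝ) (a : r₁ → ℝ) (b : r₂ → ℝ), M₁ *ᵥ p ≤ d₁ ∧ M₂ *ᵥ p = d₂ ∧ 0 ≤ a ∧
      a ᵥ* M₁ + b ᵥ* M₂ = z - p ∧ ∀ i, a i ≠ 0 → (M₁ *ᵥ p) i = d₁ i := by
  let K : Set (EuclideanSpace ℝ l) := {x | M₁ *ᵥ x.ofLp ≤ d₁ ∧ M₂ *ᵥ x.ofLp = d₂}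
  have hKc : IsClosed K := by
    refine IsClosed.inter (isClosed_le (f := fun x : EuclideanSpace ℝ l => M₁ *ᵥ x.ofLp) ?_ ?_)
      (isClosed_eq (f := fun x : EuclideanSpace ℝ l => M₂ *ᵥ x.ofLp) ?_ ?_)
    all_goals fun_prop
  have hKv : Convex ℝ K := by
    rintro x ⟨hx1, hx2⟩ y ⟨hy1, hy2⟩ s t hs ht hst
    refine ⟨?_, ?_⟩
    · simp only [WithLp.ofLp_add, WithLp.ofLp_smul, Matrix.mulVec_add, Matrix.mulVec_smul]
      intro i
      have := hx1 i
      have := hy1 i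
      simp only [Pi.add_apply, Pi.smul_apply, smul_eq_mul]
      have e : d₁ i = s * d₁ i + t * d₁ i := by rw [← add_mul, hst, one_mul]
      rw [e]
      gcongr
    · simp only [WithLp.ofLp_add, WithLp.ofLp_smul, Matrix.mulVec_add, Matrix.mulVec_smul, hx2, hy2,
        ← add_smul, hst, one_smul]
  obtain ⟨q, hqK, hq⟩ := exists_norm_eq_iInf_of_complete_convex (K := K)
    ⟨WithLp.toLp 2 z₀, h₁, h₂⟩ hKc.isComplete hKv (WithLp.toLp 2 z)
  rw [norm_eq_iInf_iff_real_inner_le_zero hKv hqK] at hq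
  set p := q.ofLp with hp
  -- The projection is characterized by `z - p` being maximized over the polyhedron at `p`, so the
  -- multipliers of this linear program express `z - p` in the rows.
  have hpz : ∀ x, M₁ *ᵥ x ≤ d₁ → M₂ *ᵥ x = d₂ → (z - p) ⬝ᵥ x ≤ (z - p) ⬝ᵥ p := by
    intro x hx1 hx2
    have := hq (WithLp.toLp 2 x) ⟨hx1, hx2⟩
    rw [EuclideanSpace.inner_eq_star_dotProduct] at this
    simp only [WithLp.ofLp_sub, star_trivial] at this
    rw [dotProduct_comm, dotProduct_sub] at this
    linarith
  obtain ⟨w, hw0, hwB, hwb⟩ := exists_multiplier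
    (Matrix.fromRows M₁ (Matrix.fromRows M₂ (-M₂))) (Sum.elim d₁ (Sum.elim d₂ (-d₂))) (z - p)
    ((z - p) ⬝ᵥ p) p (by
      rw [Matrix.fromRows_mulVec, Matrix.fromRows_mulVec, Matrix.neg_mulVec, hqK.2]
      rintro (i | i | i)
      · exact hqK.1 i
      · exact le_rfl
      · exact le_rfl) (by
      intro x hx
      rw [Matrix.fromRows_mulVec, Matrix.fromRows_mulVec, Matrix.neg_mulVec] at hx
      refine hpz x (fun i => hx (.inl i)) (le_antisymm (fun i => hx (.inr (.inl i))) fun i => ?_)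
      simpa using hx (.inr (.inr i)))
  refine ⟨p, w ∘ Sum.inl, (w ∘ Sum.inr) ∘ Sum.inl - (w ∘ Sum.inr) ∘ Sum.inr, hqK.1, hqK.2,
    fun i => hw0 _, ?_, ?_⟩
  · rw [← hwB, Matrix.vecMul_fromRows, Matrix.vecMul_fromRows, Matrix.sub_vecMul,
      Matrix.vecMul_neg, sub_eq_add_neg]
  -- Complementary slackness: a sum of nonnegative terms is at most 0.
  · have h3 : (w ∘ Sum.inl) ⬝ᵥ (d₁ - M₁ *ᵥ p) ≤ 0 := by
      rw [← hwB, ← Matrix.dotProduct_mulVec, Matrix.fromRows_mulVec, Matrix.fromRows_mulVec,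
        Matrix.neg_mulVec, hqK.2] at hwb
      rw [dotProduct_sub]
      simp only [dotProduct, Fintype.sum_sum_type, Sum.elim_inl, Sum.elim_inr,
        Function.comp_apply] at hwb ⊢
      linarith
    have h4 : ∀ i ∈ Finset.univ, 0 ≤ w (.inl i) * (d₁ - M₁ *ᵥ p) i :=
      fun i _ => mul_nonneg (hw0 _) (sub_nonneg.2 (hqK.1 i))
    have h5 := (Finset.sum_eq_zero_iff_of_nonneg h4).1 (le_antisymm h3 (Finset.sum_nonneg h4))
    intro i hi
    have h6 := (mul_eq_zero.1 (h5 i (Finset.mem_univ i))).resolve_left hi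
    simp only [Pi.sub_apply, sub_eq_zero] at h6
    exact h6.symm

variable [DecidableEq r₁]

theorem robinsonSigma_nonneg (M₁ : Matrix r₁ l ℝ) (M₂ : Matrix r₂ l ℝ) :
    0 ≤ robinsonSigma ∞ 2 M₁ M₂ :=
  Real.iSup_nonneg fun _ => robinsonMu_nonneg _ _

/-- Robinson's error bound for systems of linear inequalities and equations. -/
theorem exists_dist_le_robinsonSigma (M₁ : Matrix r₁ l ℝ) (M₂ : Matrix r₂ l ℝ) (d₁ : r₁ → ℝ)
    (d₂ : r₂ → ℝ) (z z₀ : l → ℝ) (h₁ : M₁ *ᵥ z₀ ≤ d₁) (h₂ : M₂ *ᵥ z₀ = d₂) :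
    ∃ p : l → ℝ, M₁ *ᵥ p ≤ d₁ ∧ M₂ *ᵥ p = d₂ ∧ lpN 2 (z - p) ≤ robinsonSigma ∞ 2 M₁ M₂ *
      (∑ i, max ((M₁ *ᵥ z) i - d₁ i) 0 + ∑ i, |(M₂ *ᵥ z) i - d₂ i|) := by
  obtain ⟨p, a, b, hp1, hp2, ha0, hab, hact⟩ := exists_projection M₁ M₂ d₁ d₂ z z₀ h₁ h₂
  refine ⟨p, hp1, hp2, ?_⟩
  set R := ∑ i, max ((M₁ *ᵥ z) i - d₁ i) 0 + ∑ i, |(M₂ *ᵥ z) i - d₂ i| with hR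
  have hR0 : 0 ≤ R := add_nonneg (Finset.sum_nonneg fun i _ => le_max_right _ _)
    (Finset.sum_nonneg fun i _ => abs_nonneg _)
  set G := lpN 2 (z - p) with hG
  rcases (lpN_two_nonneg (z - p)).eq_or_lt with h0 | hpos
  · rw [hG, ← h0]
    exact mul_nonneg (robinsonSigma_nonneg _ _) hR0
  rw [← hG] at hpos
  have hs : ∀ ε : ℝ, 0 < ε → G ≤ (robinsonSigma ∞ 2 M₁ M₂ + ε) * R := by
    intro ε hε
    -- `S` collects the rows with zero multiplier. The rows `I_S` and `-I` with right-hand side 0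
    -- then force `u` to be nonnegative on inequality rows and to vanish on `S`, so `u` is a
    -- multiplier of the unit vector `G⁻¹ • (z - p)` that charges only rows active at `p` but is
    -- bounded by the constant.
    let S : Finset r₁ := Finset.univ.filter fun i => a i = 0
    obtain ⟨u, hu1, hu2, hu3⟩ := exists_lpN_top_lt_robinsonMu_add
      (Matrix.fromRows
        (Matrix.fromCols ((1 : Matrix r₁ r₁ ℝ).submatrix (fun i : S => (i : r₁)) id)
          (0 : Matrix S r₂ ℝ))
        (Matrix.fromCols (-1 : Matrix r₁ r₁ ℝ) (0 : Matrix r₁ r₂ ℝ)))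
      (Matrix.fromRows M₁ M₂)ᵀ (d' := 0) (d'' := G⁻¹ • (z - p))
      (u := G⁻¹ • Sum.elim a b) (by
        rw [Matrix.mulVec_smul, Matrix.fromRows_mulVec, Matrix.fromCols_mulVec,
          Matrix.fromCols_mulVec]
        rintro (⟨i, hi⟩ | i)
        · simp only [S, Finset.mem_filter, Finset.mem_univ, true_and] at hi
          simp [Matrix.mulVec, Matrix.submatrix, dotProduct, Matrix.one_apply, hi]
        · have := ha0 i
          simp only [Pi.zero_apply] at this
          simp [Matrix.neg_mulVec]
          positivity) (by
        rw [Matrix.mulVec_smul, Matrix.mulVec_transpose, Matrix.vecMul_fromRows]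
        simp [hab]) (by
        rw [lpN_two]
        simp only [Fintype.sum_sum_type, Sum.elim_inl, Sum.elim_inr, Pi.zero_apply, Pi.smul_apply,
          smul_eq_mul, mul_pow, ← Finset.mul_sum]
        have : ∑ i, (z - p) i ^ 2 = G ^ 2 := by
          rw [hG, lpN_two_sq]
          simp [dotProduct, sq]
        rw [this]
        simp [hpos.ne']) hε
    have hσ := le_ciSup (f := fun S : Finset r₁ => robinsonMu ∞ 2
      (Matrix.fromRows
        (Matrix.fromCols ((1 : Matrix r₁ r₁ ℝ).submatrix (fun i : S => (i : r₁)) id)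
          (0 : Matrix S r₂ ℝ))
        (Matrix.fromCols (-1 : Matrix r₁ r₁ ℝ) (0 : Matrix r₁ r₂ ℝ)))
      (Matrix.fromRows M₁ M₂)ᵀ) (Set.finite_range _).bddAbove S
    have hu4 : ∀ i, |u i| ≤ robinsonSigma ∞ 2 M₁ M₂ + ε := fun i =>
      (abs_apply_le_lpN_top u i).trans (hu3.le.trans (add_le_add_left hσ ε))
    have hua : ∀ i, a i = 0 → u (.inl i) ≤ 0 := by
      intro i hi
      have := hu1 (.inl ⟨i, by simp [S, hi]⟩)
      rw [Matrix.fromRows_mulVec, Matrix.fromCols_mulVec] at this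
      simpa [Matrix.mulVec, Matrix.submatrix, dotProduct, Matrix.one_apply] using this
    have hu0 : ∀ i, 0 ≤ u (.inl i) := by
      intro i
      have := hu1 (.inr i)
      rw [Matrix.fromRows_mulVec, Matrix.fromCols_mulVec, Matrix.fromCols_mulVec] at this
      simpa [Matrix.neg_mulVec] using this
    -- Pairing `G⁻¹ • (z - p)` with `z - p` gives `G` on one side and, through `u`, the residuals of
    -- `z` on the other.
    have hGu : G = (u ∘ Sum.inl) ⬝ᵥ (M₁ *ᵥ z - M₁ *ᵥ p) + (u ∘ Sum.inr) ⬝ᵥ (M₂ *ᵥ z - d₂) := by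
      rw [Matrix.mulVec_transpose] at hu2
      have h3 : (G⁻¹ • (z - p)) ⬝ᵥ (z - p) = G := by
        rw [smul_dotProduct, ← lpN_two_sq, ← hG, smul_eq_mul]
        field_simp
      rw [← hu2, ← Matrix.dotProduct_mulVec, Matrix.fromRows_mulVec, Matrix.mulVec_sub,
        Matrix.mulVec_sub, hp2] at h3
      rw [← h3]
      simp [dotProduct, Fintype.sum_sum_type]
    rw [hGu, hR, mul_add, Finset.mul_sum, Finset.mul_sum]
    refine add_le_add (Finset.sum_le_sum fun i _ => ?_) (Finset.sum_le_sum fun i _ => ?_)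
    · by_cases hi : a i = 0
      · have h3 : u (.inl i) = 0 := le_antisymm (hua i hi) (hu0 i)
        simp only [Function.comp_apply, h3, zero_mul]
        exact mul_nonneg ((abs_nonneg _).trans (hu4 (.inl i))) (le_max_right _ _)
      · simp only [Function.comp_apply, Pi.sub_apply, hact i hi]
        exact (mul_le_mul_of_nonneg_left (le_max_left _ _) (hu0 i)).trans
          (mul_le_mul_of_nonneg_right ((le_abs_self _).trans (hu4 _)) (le_max_right _ _))
    · refine (le_abs_self _).trans ?_
      rw [abs_mul]
      exact mul_le_mul_of_nonneg_right (hu4 _) (abs_nonneg _)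
  refine le_of_forall_pos_le_add fun ε hε => ?_
  have h5 := hs (ε / (R + 1)) (by positivity)
  have h6 : ε / (R + 1) * R ≤ ε := by
    rw [div_mul_eq_mul_div, div_le_iff₀ (by positivity)]
    nlinarith
  linarith

end Robinson

/-! ### The Dantzig selector: solvability and linear programming duality -/

variable {m n : ℕ}

theorem dotProduct_transpose_mulVec (A : Matrix (Fin m) (Fin n) ℝ) (h : Fin n → ℝ)
    (y : Fin m → ℝ) : h ⬝ᵥ (Aᵀ *ᵥ y) = y ⬝ᵥ (A *ᵥ h) := by
  rw [Matrix.mulVec_transpose, dotProduct_comm, Matrix.dotProduct_mulVec]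

theorem mulVec_surjective_of_rank {A : Matrix (Fin m) (Fin n) ℝ} (hA : A.rank = m) :
    Function.Surjective A.mulVec := by
  have : LinearMap.range A.mulVecLin = ⊤ := by
    apply Submodule.eq_top_of_finrank_eq
    rw [Module.finrank_fin_fun]
    exact hA
  exact LinearMap.range_eq_top.1 this

theorem dsResidual_le_iff (A : Matrix (Fin m) (Fin n) ℝ) (y : Fin m → ℝ) (x : Fin n → ℝ) {τ : ℝ}
    (hτ : 0 ≤ τ) :
    dsResidual A y x ≤ τ ↔ ∀ i, |(Aᵀ *ᵥ (A *ᵥ x)) i - (Aᵀ *ᵥ y) i| ≤ τ := by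
  rw [dsResidual, lpN_top_le_iff _ hτ, Matrix.mulVec_sub]
  rfl

theorem dsResidual_nonneg (A : Matrix (Fin m) (Fin n) ℝ) (y : Fin m → ℝ) (x : Fin n → ℝ) :
    0 ≤ dsResidual A y x := lpN_top_nonneg _

/-- Full row rank makes `Aᵀ` injective: with `Ax - y = Aw`, its squared norm is `w · Aᵀ(Ax - y) =
0`. Thus `τ = 0` is basis pursuit. -/
theorem dsResidual_eq_zero_iff {A : Matrix (Fin m) (Fin n) ℝ} (hA : A.rank = m) (y : Fin m → ℝ)
    (x : Fin n → ℝ) : dsResidual A y x ≤ 0 ↔ A *ᵥ x = y := by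
  constructor
  · intro h
    obtain ⟨w, hw⟩ := mulVec_surjective_of_rank hA (A *ᵥ x - y)
    have h1 : Aᵀ *ᵥ (A *ᵥ x - y) = 0 := by
      ext i
      exact abs_nonpos_iff.1 ((abs_apply_le_lpN_top _ i).trans h)
    have h2 : (A *ᵥ x - y) ⬝ᵥ (A *ᵥ x - y) = 0 := by
      conv_lhs => rw [← hw]
      rw [hw, ← dotProduct_zero w, ← h1, dotProduct_transpose_mulVec, hw]
    exact sub_eq_zero.1 (dotProduct_self_eq_zero.1 h2)
  · rintro rfl
    simp [dsResidual, lpN]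

theorem exists_isOptimal {A : Matrix (Fin m) (Fin n) ℝ} (hA : A.rank = m) (y : Fin m → ℝ) {τ : ℝ}
    (hτ : 0 ≤ τ) : ∃ x, IsOptimal A y τ x := by
  obtain ⟨x₀, hx₀⟩ := mulVec_surjective_of_rank hA y
  have hx₀' : dsResidual A y x₀ ≤ τ := ((dsResidual_eq_zero_iff hA y x₀).2 hx₀).trans hτ
  have hc1 : Continuous fun x : Fin n → ℝ => lpN 1 x := by
    simp only [lpN_one]
    fun_prop
  have hc2 : Continuous fun x : Fin n → ℝ => dsResidual A y x := by
    simp only [dsResidual, lpN_top]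
    fun_prop
  have hcomp : IsCompact {x : Fin n → ℝ | dsResidual A y x ≤ τ ∧ lpN 1 x ≤ lpN 1 x₀} := by
    refine Metric.isCompact_of_isClosed_isBounded
      ((isClosed_le hc2 continuous_const).inter (isClosed_le hc1 continuous_const)) ?_
    refine (Metric.isBounded_closedBall (x := (0 : Fin n → ℝ)) (r := lpN 1 x₀)).subset ?_
    rintro x ⟨-, hx⟩
    rw [mem_closedBall_zero_iff, ← lpN_top, lpN_top_le_iff _ (show 0 ≤ lpN 1 x₀ from norm_nonneg _)]
    intro i
    refine le_trans ?_ hx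
    rw [lpN_one]
    exact Finset.single_le_sum (f := fun i => |x i|) (fun i _ => abs_nonneg _) (Finset.mem_univ i)
  obtain ⟨x, ⟨hx1, hx2⟩, hmin⟩ := hcomp.exists_isMinOn ⟨x₀, hx₀', le_rfl⟩ hc1.continuousOn
  refine ⟨x, hx1, fun z hz => ?_⟩
  rcases le_total (lpN 1 z) (lpN 1 x₀) with h | h
  · exact hmin ⟨hz, h⟩
  · exact hx2.trans h

theorem dotProduct_le_of_abs_le {ι : Type*} [Fintype ι] {a b : ι → ℝ} {r : ℝ}
    (hb : ∀ i, |b i| ≤ r) : |a ⬝ᵥ b| ≤ r * ∑ i, |a i| := by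
  rw [Finset.mul_sum]
  refine (Finset.abs_sum_le_sum_abs _ _).trans (Finset.sum_le_sum fun i _ => ?_)
  rw [abs_mul, mul_comm]
  exact mul_le_mul_of_nonneg_right (hb i) (abs_nonneg _)

/-- Weak duality for the Dantzig selector. -/
theorem le_lpN_one_of_dual {A : Matrix (Fin m) (Fin n) ℝ} {y : Fin m → ℝ} {τ : ℝ} (hτ : 0 ≤ τ)
    {h x : Fin n → ℝ} (hh : ∀ i, |(Aᵀ *ᵥ (A *ᵥ h)) i| ≤ 1) (hx : dsResidual A y x ≤ τ) :
    y ⬝ᵥ (A *ᵥ h) - τ * ∑ i, |h i| ≤ lpN 1 x := by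
  rw [dsResidual_le_iff A y x hτ] at hx
  have h1 := (abs_le.1 (dotProduct_le_of_abs_le (a := h)
    (b := Aᵀ *ᵥ (A *ᵥ x) - Aᵀ *ᵥ y) hx)).1
  have h2 := (abs_le.1 (dotProduct_le_of_abs_le (a := x) (b := Aᵀ *ᵥ (A *ᵥ h)) hh)).2
  rw [dotProduct_sub, dotProduct_transpose_mulVec, dotProduct_transpose_mulVec] at h1
  rw [dotProduct_transpose_mulVec, dotProduct_comm] at h2
  rw [lpN_one]
  linarith

/-- Strong duality for the Dantzig selector. -/
theorem exists_dual_of_isOptimal {A : Matrix (Fin m) (Fin n) ℝ} {y : Fin m → ℝ} {τ : ℝ}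
    (hτ : 0 ≤ τ) {x : Fin n → ℝ} (hx : IsOptimal A y τ x) :
    ∃ w₁ w₂ w₄ w₅ : Fin n → ℝ, 0 ≤ w₁ ∧ 0 ≤ w₂ ∧ 0 ≤ w₄ ∧ 0 ≤ w₅ ∧ w₁ + w₂ = 1 ∧
      Aᵀ *ᵥ (A *ᵥ (w₄ - w₅)) = w₁ - w₂ ∧
      lpN 1 x ≤ y ⬝ᵥ (A *ᵥ (w₄ - w₅)) - τ * (∑ i, w₄ i + ∑ i, w₅ i) := by
  let B : Matrix (Fin n ⊕ Fin n ⊕ Fin n ⊕ Fin n) (Fin n ⊕ Fin n) ℝ :=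
    .fromRows (.fromCols 1 (-1)) <| .fromRows (.fromCols (-1) (-1)) <|
      .fromRows (.fromCols (Aᵀ * A) 0) (.fromCols (-(Aᵀ * A)) 0)
  let b : Fin n ⊕ Fin n ⊕ Fin n ⊕ Fin n → ℝ :=
    Sum.elim 0 <| Sum.elim 0 <|
      Sum.elim (fun i => τ + (Aᵀ *ᵥ y) i) (fun i => τ - (Aᵀ *ᵥ y) i)
  have hB : ∀ u t : Fin n → ℝ, B *ᵥ (Sum.elim u t) = Sum.elim (u - t) (Sum.elim (-u - t)
      (Sum.elim (Aᵀ *ᵥ (A *ᵥ u)) (-(Aᵀ *ᵥ (A *ᵥ u))))) := by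
    intro u t
    simp only [B, Matrix.fromRows_mulVec, Matrix.fromCols_mulVec, Sum.elim_comp_inl,
      Sum.elim_comp_inr, Matrix.neg_mulVec, Matrix.one_mulVec, Matrix.zero_mulVec, add_zero,
      ← Matrix.mulVec_mulVec, sub_eq_add_neg]
  have hxf := (dsResidual_le_iff A y x hτ).1 hx.1
  -- Minimizing `‖x‖₁` becomes a linear program in `(x, t)` with `|x i| ≤ t i`; optimality says that
  -- `-∑ t ≤ -‖x‖₁` is valid on its feasible set.
  obtain ⟨l, hl0, hlB, hlb⟩ := exists_multiplier B b (Sum.elim 0 (-1)) (-lpN 1 x)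
    (Sum.elim x fun i => |x i|) (by
      rw [hB]
      rintro (i | i | i | i)
      · simpa [b] using le_abs_self (x i)
      · simpa [b] using neg_le_abs (x i)
      · have := (abs_le.1 (hxf i)).2
        simp only [b, Sum.elim_inr, Sum.elim_inl]
        linarith
      · have := (abs_le.1 (hxf i)).1
        simp only [b, Sum.elim_inr, Pi.neg_apply]
        linarith) (by
      intro u hu
      rw [← Sum.elim_comp_inl_inr u, hB] at hu
      have h1 := hx.2 (u ∘ Sum.inl) ((dsResidual_le_iff A y _ hτ).2 fun i => by
        have h2 := hu (.inr (.inr (.inl i)))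
        have h3 := hu (.inr (.inr (.inr i)))
        simp only [b, Sum.elim_inr, Sum.elim_inl, Pi.neg_apply] at h2 h3
        rw [abs_le]
        constructor <;> linarith)
      have h4 : lpN 1 (u ∘ Sum.inl) ≤ ∑ i, u (.inr i) := by
        rw [lpN_one]
        refine Finset.sum_le_sum fun i _ => ?_
        have h2 := hu (.inl i)
        have h3 := hu (.inr (.inl i))
        simp only [b, Sum.elim_inr, Sum.elim_inl, Pi.zero_apply, Pi.sub_apply, Pi.neg_apply,
          Function.comp_apply] at h2 h3
        rw [abs_le]
        simp only [Function.comp_apply]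
        constructor <;> linarith
      simp only [dotProduct, Fintype.sum_sum_type, Sum.elim_inl, Sum.elim_inr, Pi.zero_apply,
        zero_mul, Finset.sum_const_zero, Pi.neg_apply, Pi.one_apply, neg_mul, one_mul, zero_add,
        Finset.sum_neg_distrib]
      linarith)
  have hG : (Aᵀ * A)ᵀ = Aᵀ * A := by simp
  simp only [B, Matrix.vecMul_fromRows, Matrix.vecMul_fromCols, Matrix.vecMul_neg,
    Matrix.vecMul_one, Matrix.vecMul_zero] at hlB
  have hc1 := congrArg (fun f => f ∘ Sum.inl) hlB
  have hc2 := congrArg (fun f => f ∘ Sum.inr) hlB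
  set l₁ := l ∘ Sum.inl
  set l₂ := (l ∘ Sum.inr) ∘ Sum.inl
  set l₄ := ((l ∘ Sum.inr) ∘ Sum.inr) ∘ Sum.inl with hl4
  set l₅ := ((l ∘ Sum.inr) ∘ Sum.inr) ∘ Sum.inr with hl5
  have hc3 : l₁ + (-l₂ + (l₄ ᵥ* (Aᵀ * A) + -(l₅ ᵥ* (Aᵀ * A)))) = 0 := hc1
  have hc4 : -l₁ + (-l₂ + (0 + 0)) = -1 := hc2
  rw [← Matrix.mulVec_transpose, ← Matrix.mulVec_transpose, hG, ← Matrix.mulVec_mulVec,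
    ← Matrix.mulVec_mulVec] at hc3
  -- The last two multipliers change places: the dual vector is `l₅ - l₄`, since the constraint
  -- `AᵀAx ≤ τ + Aᵀy` enters the dual with a negative sign.
  refine ⟨l₁, l₂, l₅, l₄, fun i => hl0 _, fun i => hl0 _, fun i => hl0 _, fun i => hl0 _, ?_, ?_,
    ?_⟩
  · rw [← neg_inj, ← hc4]
    abel
  · rw [Matrix.mulVec_sub, Matrix.mulVec_sub, ← sub_eq_zero, ← neg_eq_zero, ← hc3]
    abel
  · have h1 : l ⬝ᵥ b = l₄ ⬝ᵥ (fun i => τ + (Aᵀ *ᵥ y) i) + l₅ ⬝ᵥ (fun i => τ - (Aᵀ *ᵥ y) i) := by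
      simp [b, dotProduct, Fintype.sum_sum_type, hl4, hl5]
    have h2 : l₄ ⬝ᵥ (fun i => τ + (Aᵀ *ᵥ y) i) = τ * ∑ i, l₄ i + y ⬝ᵥ (A *ᵥ l₄) := by
      rw [← dotProduct_transpose_mulVec]
      simp only [dotProduct, mul_add, Finset.sum_add_distrib, mul_comm τ, Finset.sum_mul]
    have h3 : l₅ ⬝ᵥ (fun i => τ - (Aᵀ *ᵥ y) i) = τ * ∑ i, l₅ i - y ⬝ᵥ (A *ᵥ l₅) := by
      rw [← dotProduct_transpose_mulVec]
      simp only [dotProduct, mul_sub, Finset.sum_sub_distrib, mul_comm τ, Finset.sum_mul]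
    rw [h1, h2, h3] at hlb
    rw [Matrix.mulVec_sub, dotProduct_sub]
    linarith

theorem abs_sub_le_one_of_add_le_one {a b : ℝ} (ha : 0 ≤ a) (hb : 0 ≤ b) (h : a + b ≤ 1) :
    |a - b| ≤ 1 := by
  rw [abs_le]
  constructor <;> linarith

/-- The signed indicator of a pair of disjoint sets. -/
noncomputable def signVec (S₁ S₂ : Finset (Fin n)) (i : Fin n) : ℝ :=
  if i ∈ S₁ then 1 else if i ∈ S₂ then -1 else 0

/-- With `τ = 0`, strong duality gives `ζ = Aᵀz` with `‖ζ‖_∞ ≤ 1` and `‖s‖₁ ≤ s·ζ`. Equality must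
hold entrywise, so `ζ` equals the sign of `s` wherever `s` is nonzero. -/
theorem weakRSP_of_isOptimal {A : Matrix (Fin m) (Fin n) ℝ} {k : ℕ}
    (h : ∀ S₁ S₂ : Finset (Fin n), Disjoint S₁ S₂ → S₁.card + S₂.card ≤ k →
      IsOptimal A (A *ᵥ signVec S₁ S₂) 0 (signVec S₁ S₂)) : WeakRSP A k := by
  intro S₁ S₂ hS hk
  obtain ⟨w₁, w₂, w₄, w₅, h1, h2, -, -, h12, hζ, hle⟩ :=
    exists_dual_of_isOptimal le_rfl (h S₁ S₂ hS hk)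
  set z := A *ᵥ (w₄ - w₅)
  set s := signVec S₁ S₂ with hs
  have hz : ∀ i, |(Aᵀ *ᵥ z) i| ≤ 1 := fun i => by
    rw [hζ]
    exact abs_sub_le_one_of_add_le_one (h1 i) (h2 i) (congrFun h12 i).le
  rw [zero_mul, sub_zero, dotProduct_comm, ← dotProduct_transpose_mulVec, lpN_one] at hle
  have hnn : ∀ i ∈ Finset.univ, 0 ≤ |s i| - s i * (Aᵀ *ᵥ z) i := fun i _ => by
    have h3 : |s i * (Aᵀ *ᵥ z) i| ≤ |s i| := by
      rw [abs_mul]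
      exact mul_le_of_le_one_right (abs_nonneg _) (hz i)
    linarith [le_abs_self (s i * (Aᵀ *ᵥ z) i)]
  have h0 := (Finset.sum_eq_zero_iff_of_nonneg hnn).1 (le_antisymm (by
    rw [Finset.sum_sub_distrib]
    exact sub_nonpos.2 hle) (Finset.sum_nonneg hnn))
  refine ⟨z, fun i hi => ?_, fun i hi => ?_, fun i _ => hz i⟩
  · have := h0 i (Finset.mem_univ i)
    simp only [hs, signVec, hi, if_true, abs_one, one_mul] at this
    linarith
  · have := h0 i (Finset.mem_univ i)
    simp only [hs, signVec, hi, Finset.disjoint_right.1 hS hi, if_true, if_false, abs_neg, abs_one,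
      neg_mul, one_mul] at this
    linarith

/-! ### The constant `c_A` and preimages of small norm -/

theorem bddAbove_inducedNorm {ι κ : Type*} [Fintype ι] [Fintype κ] (Q : Matrix ι κ ℝ) :
    BddAbove {c | ∃ x : κ → ℝ, lpN ∞ x ≤ 1 ∧ c = lpN 1 (Q *ᵥ x)} := by
  refine ⟨∑ i, ∑ j, |Q i j|, ?_⟩
  rintro _ ⟨x, hx, rfl⟩
  rw [lpN_one]
  refine Finset.sum_le_sum fun i _ => ?_
  have := dotProduct_le_of_abs_le (a := Q i) (b := x) (r := 1)
    fun j => (abs_apply_le_lpN_top x j).trans hx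
  rwa [one_mul] at this

theorem lpN_one_mulVec_le_inducedNorm {ι κ : Type*} [Fintype ι] [Fintype κ] (Q : Matrix ι κ ℝ)
    {x : κ → ℝ} (hx : ∀ i, |x i| ≤ 1) : lpN 1 (Q *ᵥ x) ≤ inducedNorm ∞ 1 Q :=
  le_csSup (bddAbove_inducedNorm Q) ⟨x, (lpN_top_le_iff x zero_le_one).2 hx, rfl⟩

theorem inducedNorm_nonneg {ι κ : Type*} [Fintype ι] [Fintype κ] (Q : Matrix ι κ ℝ) :
    0 ≤ inducedNorm ∞ 1 Q := by
  refine Real.sSup_nonneg ?_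
  rintro _ ⟨x, -, rfl⟩
  exact norm_nonneg _

theorem cA_nonneg (A : Matrix (Fin m) (Fin n) ℝ) : 0 ≤ cA A := by
  refine Real.sSup_nonneg ?_
  rintro _ ⟨G, hG, -, rfl⟩
  exact inducedNorm_nonneg _

theorem inducedNorm_le_cA (A : Matrix (Fin m) (Fin n) ℝ) (G : Finset (Fin n)) (hG : G.card = m)
    (hu : IsUnit (A.submatrix id (G.orderEmbOfFin hG))) :
    inducedNorm ∞ 1 ((A.submatrix id (G.orderEmbOfFin hG))⁻¹ * (A * Aᵀ)⁻¹ * A) ≤ cA A := by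
  refine le_csSup (Set.Finite.bddAbove ((Set.finite_range
    (fun p : {G : Finset (Fin n) // G.card = m} =>
      inducedNorm ∞ 1 ((A.submatrix id (p.1.orderEmbOfFin p.2))⁻¹ * (A * Aᵀ)⁻¹ * A))).subset ?_))
    ⟨G, hG, hu, rfl⟩
  rintro _ ⟨G, hG, -, rfl⟩
  exact ⟨⟨G, hG⟩, rfl⟩

/-- The columns span the whole space, so a maximal independent family of them is a basis. This makes
the family defining `c_A` nonempty. -/
theorem exists_isUnit_submatrix {A : Matrix (Fin m) (Fin n) ℝ} (hA : A.rank = m) :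
    ∃ (G : Finset (Fin n)) (hG : G.card = m), IsUnit (A.submatrix id (G.orderEmbOfFin hG)) := by
  classical
  obtain ⟨b, -, -, hspan, hli⟩ := exists_linearIndepOn_extension (K := ℝ) (v := A.col)
    (linearIndepOn_empty ℝ A.col) (Set.empty_subset Set.univ)
  rw [Set.image_univ] at hspan
  have htop : Submodule.span ℝ (Set.range A.col) = ⊤ := by
    rw [← Matrix.range_mulVecLin]
    exact LinearMap.range_eq_top.2 (mulVec_surjective_of_rank hA)
  have htop' : Submodule.span ℝ (A.col '' b) = ⊤ := by
    rw [eq_top_iff, ← htop]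
    exact Submodule.span_le.2 hspan
  let G : Finset (Fin n) := b.toFinset
  have hGm : G.card = m := by
    have h1 := finrank_span_eq_card (R := ℝ) (b := fun j : b => A.col j) hli
    have h2 : Set.range (fun j : b => A.col j) = A.col '' b := by
      rw [Set.image_eq_range]
    rw [h2, htop', finrank_top, Module.finrank_fin_fun] at h1
    rw [h1, Set.toFinset_card]
  refine ⟨G, hGm, ?_⟩
  rw [← Matrix.linearIndependent_cols_iff_isUnit]
  have hmem : ∀ i, G.orderEmbOfFin hGm i ∈ b := fun i => by
    have := G.orderEmbOfFin_mem hGm i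
    exact Set.mem_toFinset.1 this
  exact LinearIndependent.comp hli (fun i => (⟨G.orderEmbOfFin hGm i, hmem i⟩ : b))
    fun i j hij => (G.orderEmbOfFin hGm).injective (by simpa using hij)

theorem isUnit_mul_transpose {A : Matrix (Fin m) (Fin n) ℝ} (hA : A.rank = m) :
    IsUnit (A * Aᵀ) := by
  rw [← Matrix.mulVec_surjective_iff_isUnit]
  refine mulVec_surjective_of_rank ?_
  rw [Matrix.rank_self_mul_transpose, hA]

/-- A vector `u` with `‖Aᵀ u‖_∞ ≤ 1` has a preimage under `A` of `ℓ_1`-norm at most `c_A`. -/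
theorem exists_preimage_lpN_one_le_cA {A : Matrix (Fin m) (Fin n) ℝ} (hA : A.rank = m)
    (u : Fin m → ℝ) (hu : ∀ i, |(Aᵀ *ᵥ u) i| ≤ 1) :
    ∃ h : Fin n → ℝ, A *ᵥ h = u ∧ ∑ i, |h i| ≤ cA A := by
  obtain ⟨G, hG, hunit⟩ := exists_isUnit_submatrix hA
  set e := G.orderEmbOfFin hG
  set AG := A.submatrix id e with hAG
  -- Since `(AAᵀ)⁻¹A` recovers `u` from `Aᵀu`, this is `A_G⁻¹u`, written so that the matrix in `c_A`
  -- acts on a vector of sup-norm at most 1.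
  set g := (AG⁻¹ * (A * Aᵀ)⁻¹ * A) *ᵥ (Aᵀ *ᵥ u) with hg
  have hg' : AG *ᵥ g = u := by
    have e1 : AG * (AG⁻¹ * (A * Aᵀ)⁻¹ * A) * Aᵀ = AG * AG⁻¹ * ((A * Aᵀ)⁻¹ * (A * Aᵀ)) := by
      simp only [Matrix.mul_assoc]
    rw [hg, Matrix.mulVec_mulVec, Matrix.mulVec_mulVec, e1, Matrix.nonsing_inv_mul _ ((Matrix.isUnit_iff_isUnit_det _).1
        (isUnit_mul_transpose hA)), Matrix.mul_one,
      Matrix.mul_nonsing_inv _ ((Matrix.isUnit_iff_isUnit_det _).1 hunit), Matrix.one_mulVec]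
  refine ⟨∑ i, g i • Pi.single (e i) (1 : ℝ), ?_, ?_⟩
  · rw [← hg', mulVec_eq_sum_col AG, Matrix.mulVec_sum]
    refine Finset.sum_congr rfl fun i _ => ?_
    rw [Matrix.mulVec_smul, Matrix.mulVec_single_one]
    rfl
  · have h1 := (lpN_one_mulVec_le_inducedNorm (AG⁻¹ * (A * Aᵀ)⁻¹ * A) hu).trans
      (inducedNorm_le_cA A G hG hunit)
    rw [lpN_one] at h1
    refine le_trans ?_ h1
    calc ∑ j, |(∑ i, g i • (Pi.single (e i) (1 : ℝ) : Fin n → ℝ)) j|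
        ≤ ∑ j, ∑ i, |g i * (Pi.single (e i) (1 : ℝ) : Fin n → ℝ) j| := by
          refine Finset.sum_le_sum fun j _ => ?_
          rw [Finset.sum_apply]
          exact Finset.abs_sum_le_sum_abs _ _
      _ = ∑ i, |g i| := by
          rw [Finset.sum_comm]
          refine Finset.sum_congr rfl fun i _ => ?_
          simp [Pi.single_apply, abs_ite]

/-! ### Best `k`-term approximation and dual vectors -/

/-- Any competitor `u` costs at least the mass of `x` off the support of `u`, so a best set among
the finitely many of size at most `k` does no worse than the infimum. -/
theorem exists_sum_compl_le_bestTermError (k : ℕ) (x : Fin n → ℝ) :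
    ∃ S : Finset (Fin n), S.card ≤ k ∧ ∑ i ∈ Sᶜ, |x i| ≤ bestTermError k x := by
  obtain ⟨S, hS, hmin⟩ := Finset.exists_min_image
    (Finset.univ.filter fun S : Finset (Fin n) => S.card ≤ k) (fun S => ∑ i ∈ Sᶜ, |x i|)
    ⟨∅, by simp⟩
  simp only [Finset.mem_filter, Finset.mem_univ, true_and] at hS hmin
  refine ⟨S, hS, le_csInf ⟨_, 0, by simp, rfl⟩ ?_⟩
  rintro _ ⟨u, hu, rfl⟩
  refine (hmin (Finset.univ.filter fun i => u i ≠ 0) hu).trans ?_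
  rw [lpN_one]
  refine (Finset.sum_le_sum fun i hi => ?_).trans (Finset.sum_le_sum_of_subset_of_nonneg
    (Finset.subset_univ _) fun i _ _ => abs_nonneg ((x - u) i))
  simp only [Finset.mem_compl, Finset.mem_filter, Finset.mem_univ, true_and, not_not] at hi
  simp [hi]

theorem bestTermError_nonneg (k : ℕ) (x : Fin n → ℝ) : 0 ≤ bestTermError k x := by
  obtain ⟨S, -, hS⟩ := exists_sum_compl_le_bestTermError k x
  exact (Finset.sum_nonneg fun i _ => abs_nonneg _).trans hS

/-- Under the weak range space property every vector `x` has a dual vector whose pairing with `x`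
is its `ℓ_1`-norm up to twice the error of the best `k`-term approximation. -/
theorem WeakRSP.exists_dual {A : Matrix (Fin m) (Fin n) ℝ} {k : ℕ} (h : WeakRSP A k)
    (x : Fin n → ℝ) : ∃ u : Fin m → ℝ, (∀ i, |(Aᵀ *ᵥ u) i| ≤ 1) ∧
      ∑ i, |x i| - x ⬝ᵥ (Aᵀ *ᵥ u) ≤ 2 * bestTermError k x := by
  obtain ⟨S, hSk, hS⟩ := exists_sum_compl_le_bestTermError k x
  have hdisj : Disjoint (S.filter fun i => 0 < x i) (S.filter fun i => x i < 0) :=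
    Finset.disjoint_filter.2 fun i _ h1 h2 => lt_asymm h1 h2
  obtain ⟨u, hu1, hu2, hu3⟩ := h (S.filter fun i => 0 < x i) (S.filter fun i => x i < 0) hdisj (by
    rw [← Finset.card_union_of_disjoint hdisj]
    exact (Finset.card_le_card (Finset.union_subset (Finset.filter_subset _ _)
      (Finset.filter_subset _ _))).trans hSk)
  have hu : ∀ i, |(Aᵀ *ᵥ u) i| ≤ 1 := by
    intro i
    by_cases h1 : i ∈ S.filter fun i => 0 < x i
    · rw [hu1 i h1, abs_one]
    by_cases h2 : i ∈ S.filter fun i => x i < 0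
    · rw [hu2 i h2, abs_neg, abs_one]
    · exact hu3 i (by simp only [Finset.mem_union]; tauto)
  refine ⟨u, hu, le_trans ?_ (mul_le_mul_of_nonneg_left hS zero_le_two)⟩
  -- On `S` the pairing is exact; off `S` each entry loses at most `2|x i|`.
  rw [dotProduct, ← Finset.sum_sub_distrib, ← Finset.sum_add_sum_compl S, Finset.mul_sum]
  have h0 : ∑ i ∈ S, (|x i| - x i * (Aᵀ *ᵥ u) i) = 0 := by
    refine Finset.sum_eq_zero fun i hi => ?_
    rcases lt_trichotomy (x i) 0 with h | h | h
    · rw [hu2 i (by simp [hi, h]), abs_of_neg h]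
      ring
    · simp [h]
    · rw [hu1 i (by simp [hi, h]), abs_of_pos h]
      ring
  rw [h0, zero_add]
  refine Finset.sum_le_sum fun i _ => ?_
  have h1 : |x i * (Aᵀ *ᵥ u) i| ≤ |x i| := by
    rw [abs_mul]
    exact mul_le_of_le_one_right (abs_nonneg _) (hu i)
  linarith [neg_abs_le (x i * (Aᵀ *ᵥ u) i)]

/-! ### The primal-dual optimality system and the error bound -/

section KKT

/-- The vector with blocks `x, t, ξ, v, w⁽¹⁾, …, w⁽⁷⁾`. -/
def kktPoint (x t : Fin n → ℝ) (xi : ℝ) (v w1 w2 : Fin n → ℝ) (w3 : ℝ) (w4 w5 w6 w7 : Fin n → ℝ) :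
    KKTVar n n → ℝ :=
  Sum.elim x <| Sum.elim t <| Sum.elim (fun _ => xi) <| Sum.elim v <| Sum.elim w1 <|
    Sum.elim w2 <| Sum.elim (fun _ => w3) <| Sum.elim w4 <| Sum.elim w5 <| Sum.elim w6 w7

theorem exists_eq_kktPoint (z : KKTVar n n → ℝ) : ∃ x t xi v w1 w2 w3 w4 w5 w6 w7,
    z = kktPoint x t xi v w1 w2 w3 w4 w5 w6 w7 := by
  refine ⟨fun i => z (.inl i), fun i => z (.inr (.inl i)), z (.inr (.inr (.inl ()))),
    fun i => z (.inr (.inr (.inr (.inl i)))),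
    fun i => z (.inr (.inr (.inr (.inr (.inl i))))),
    fun i => z (.inr (.inr (.inr (.inr (.inr (.inl i)))))),
    z (.inr (.inr (.inr (.inr (.inr (.inr (.inl ()))))))),
    fun i => z (.inr (.inr (.inr (.inr (.inr (.inr (.inr (.inl i)))))))),
    fun i => z (.inr (.inr (.inr (.inr (.inr (.inr (.inr (.inr (.inl i))))))))),
    fun i => z (.inr (.inr (.inr (.inr (.inr (.inr (.inr (.inr (.inr (.inl i)))))))))),
    fun i => z (.inr (.inr (.inr (.inr (.inr (.inr (.inr (.inr (.inr (.inr i)))))))))), ?_⟩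
  ext i
  rcases i with i | i | i | i | i | i | i | i | i | i | i <;> rfl

theorem ones_mulVec {ρ κ : Type} [Fintype κ] (v : κ → ℝ) : ones ρ κ *ᵥ v = fun _ => ∑ j, v j := by
  ext i
  simp [ones, Matrix.mulVec, dotProduct]

theorem blockRow_mulVec {ρ : Type} (X T : Matrix ρ (Fin n) ℝ) (XI : Matrix ρ Unit ℝ)
    (V W1 W2 : Matrix ρ (Fin n) ℝ) (W3 : Matrix ρ Unit ℝ) (W4 W5 W6 W7 : Matrix ρ (Fin n) ℝ)
    (x t : Fin n → ℝ) (xi : ℝ) (v w1 w2 : Fin n → ℝ) (w3 : ℝ) (w4 w5 w6 w7 : Fin n → ℝ) :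
    blockRow X T XI V W1 W2 W3 W4 W5 W6 W7 *ᵥ kktPoint x t xi v w1 w2 w3 w4 w5 w6 w7 =
      X *ᵥ x + (T *ᵥ t + (XI *ᵥ (fun _ => xi) + (V *ᵥ v + (W1 *ᵥ w1 + (W2 *ᵥ w2 +
        (W3 *ᵥ (fun _ => w3) + (W4 *ᵥ w4 + (W5 *ᵥ w5 + (W6 *ᵥ w6 + W7 *ᵥ w7))))))))) := by
  simp only [blockRow, kktPoint, Matrix.fromCols_mulVec, Sum.elim_comp_inl, Sum.elim_comp_inr]

theorem kktM₁_mulVec (A : Matrix (Fin m) (Fin n) ℝ)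
    (x t : Fin n → ℝ) (xi : ℝ) (v w1 w2 : Fin n → ℝ) (w3 : ℝ) (w4 w5 w6 w7 : Fin n → ℝ) :
    kktM₁ A A 1 *ᵥ kktPoint x t xi v w1 w2 w3 w4 w5 w6 w7 =
      Sum.elim (fun i => x i - t i) (Sum.elim (fun i => -x i - t i) (Sum.elim (fun _ => xi)
      (Sum.elim (fun i => (Aᵀ *ᵥ (A *ᵥ x)) i - xi) (Sum.elim (fun i => -(Aᵀ *ᵥ (A *ᵥ x)) i - xi)
      (Sum.elim (fun i => (Aᵀ *ᵥ (A *ᵥ x)) i - v i)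
      (Sum.elim (fun i => -(Aᵀ *ᵥ (A *ᵥ x)) i - v i)
      (Sum.elim (fun i => w1 i + w2 i) (Sum.elim (fun _ => -w3 + ∑ i, w4 i + ∑ i, w5 i)
      (Sum.elim (fun i => w6 i + w7 i) (Sum.elim (fun i => -w1 i) (Sum.elim (fun i => -w2 i)
      (Sum.elim (fun _ => -w3) (Sum.elim (fun i => -w4 i) (Sum.elim (fun i => -w5 i)
      (Sum.elim (fun i => -w6 i) (fun i => -w7 i)))))))))))))))) := by
  simp only [kktM₁, Matrix.fromRows_mulVec, blockRow_mulVec, Matrix.neg_mulVec, Matrix.one_mulVec,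
    Matrix.zero_mulVec, Matrix.smul_mulVec, ones_mulVec, ← Matrix.mulVec_mulVec]
  ext i
  rcases i with i | i | i | i | i | i | i | i | i | i | i | i | i | i | i | i | i <;>
    simp [sub_eq_add_neg, add_assoc]

theorem kktM₂_mulVec (A : Matrix (Fin m) (Fin n) ℝ) (y : Fin m → ℝ) (τ : ℝ)
    (x t : Fin n → ℝ) (xi : ℝ) (v w1 w2 : Fin n → ℝ) (w3 : ℝ) (w4 w5 w6 w7 : Fin n → ℝ) :
    kktM₂ A A y τ *ᵥ kktPoint x t xi v w1 w2 w3 w4 w5 w6 w7 =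
      Sum.elim (-w1 + w2 + Aᵀ *ᵥ (A *ᵥ (w4 - w5 - w6 + w7)))
        (fun _ => ∑ i, t i + τ * w3 - y ⬝ᵥ (A *ᵥ (w4 - w5 - w6 + w7))) := by
  have hy : ∀ w : Fin n → ℝ, yTM A y *ᵥ w = fun _ => y ⬝ᵥ (A *ᵥ w) := by
    intro w
    ext i
    rw [Matrix.dotProduct_mulVec]
    rfl
  simp only [kktM₂, Matrix.fromRows_mulVec, blockRow_mulVec, Matrix.neg_mulVec, Matrix.one_mulVec,
    Matrix.zero_mulVec, Matrix.smul_mulVec, ones_mulVec, hy, ← Matrix.mulVec_mulVec,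
    Matrix.mulVec_add, Matrix.mulVec_sub, dotProduct_add, dotProduct_sub]
  ext i
  rcases i with i | i
  · simp only [Sum.elim_inl, Pi.add_apply, Pi.neg_apply, Pi.sub_apply, Pi.zero_apply]
    ring
  · simp only [Sum.elim_inr, Pi.add_apply, Pi.neg_apply, Pi.zero_apply, Pi.smul_apply,
      smul_eq_mul, Finset.univ_unique, Finset.sum_singleton]
    ring

/-- The right-hand side of the inequalities. -/
def kktRhs (A : Matrix (Fin m) (Fin n) ℝ) (y : Fin m → ℝ) (τ : ℝ) : KKTIneq n n → ℝ :=
  Sum.elim 0 (Sum.elim 0 (Sum.elim (fun _ => τ) (Sum.elim (Aᵀ *ᵥ y) (Sum.elim (-(Aᵀ *ᵥ y))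
    (Sum.elim (Aᵀ *ᵥ y) (Sum.elim (-(Aᵀ *ᵥ y)) (Sum.elim 1 0)))))))

/-- Strong duality makes the system solvable, as Robinson's bound requires. The gap equation needs
weak duality as well, for the reverse inequality. -/
theorem exists_kkt_of_isOptimal {A : Matrix (Fin m) (Fin n) ℝ} {y : Fin m → ℝ} {τ : ℝ}
    (hτ : 0 ≤ τ) {x : Fin n → ℝ} (hx : IsOptimal A y τ x) :
    ∃ z, kktM₁ A A 1 *ᵥ z ≤ kktRhs A y τ ∧ kktM₂ A A y τ *ᵥ z = 0 := by
  obtain ⟨w₁, w₂, w₄, w₅, h1, h2, h4, h5, h12, hζ, hle⟩ := exists_dual_of_isOptimal hτ hx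
  have hxf := (dsResidual_le_iff A y x hτ).1 hx.1
  have hh : ∀ i, |(Aᵀ *ᵥ (A *ᵥ (w₄ - w₅))) i| ≤ 1 := fun i => by
    rw [hζ]
    exact abs_sub_le_one_of_add_le_one (h1 i) (h2 i) (congrFun h12 i).le
  have hsum : ∑ i, |(w₄ - w₅) i| ≤ ∑ i, w₄ i + ∑ i, w₅ i := by
    rw [← Finset.sum_add_distrib]
    refine Finset.sum_le_sum fun i _ => (abs_sub _ _).trans ?_
    rw [abs_of_nonneg (h4 i), abs_of_nonneg (h5 i)]
  have hge := le_lpN_one_of_dual hτ hh hx.1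
  have hge' := mul_le_mul_of_nonneg_left hsum hτ
  have h40 : 0 ≤ ∑ i, w₄ i := Finset.sum_nonneg fun i _ => h4 i
  have h50 : 0 ≤ ∑ i, w₅ i := Finset.sum_nonneg fun i _ => h5 i
  -- For `α = 1` the blocks `v, w⁽⁶⁾, w⁽⁷⁾` are inert: `v` need only dominate the residual, and the
  -- last two must vanish.
  refine ⟨kktPoint x (fun i => |x i|) τ (fun i => |(Aᵀ *ᵥ (A *ᵥ x)) i - (Aᵀ *ᵥ y) i|) w₁ w₂
    (∑ i, w₄ i + ∑ i, w₅ i) w₄ w₅ 0 0, ?_, ?_⟩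
  · rw [kktM₁_mulVec, kktRhs]
    rintro (i | i | i | i | i | i | i | i | i | i | i | i | i | i | i | i | i) <;>
      simp only [Sum.elim_inl, Sum.elim_inr, Pi.zero_apply, Pi.neg_apply, Pi.one_apply]
    · linarith [le_abs_self (x i)]
    · linarith [neg_le_abs (x i)]
    · exact le_rfl
    · linarith [(abs_le.1 (hxf i)).2]
    · linarith [(abs_le.1 (hxf i)).1]
    · linarith [le_abs_self ((Aᵀ *ᵥ (A *ᵥ x)) i - (Aᵀ *ᵥ y) i)]
    · linarith [neg_abs_le ((Aᵀ *ᵥ (A *ᵥ x)) i - (Aᵀ *ᵥ y) i)]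
    · exact (congrFun h12 i).le
    · linarith
    · linarith
    · exact neg_nonpos.2 (h1 i)
    · exact neg_nonpos.2 (h2 i)
    · linarith
    · exact neg_nonpos.2 (h4 i)
    · exact neg_nonpos.2 (h5 i)
    · linarith
    · linarith
  · rw [kktM₂_mulVec]
    simp only [sub_zero, add_zero]
    rw [lpN_one] at hle hge
    ext i
    rcases i with i | i
    · simp only [hζ, Sum.elim_inl, Pi.add_apply, Pi.neg_apply, Pi.sub_apply, Pi.zero_apply]
      ring
    · simp only [Sum.elim_inr, Pi.zero_apply]
      linarith

/-- The gap equation gives `‖x‖₁ ≤ ∑ t = y·A(w⁽⁴⁾ - w⁽⁵⁾) - τ w⁽³⁾`, which is at most the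
weak-duality lower bound for every feasible point. -/
theorem isOptimal_of_kkt {A : Matrix (Fin m) (Fin n) ℝ} {y : Fin m → ℝ} {τ : ℝ} (hτ : 0 ≤ τ)
    {z : KKTVar n n → ℝ} (hz1 : kktM₁ A A 1 *ᵥ z ≤ kktRhs A y τ) (hz2 : kktM₂ A A y τ *ᵥ z = 0) :
    IsOptimal A y τ (z ∘ Sum.inl) := by
  obtain ⟨x, t, xi, v, w1, w2, w3, w4, w5, w6, w7, rfl⟩ := exists_eq_kktPoint z
  rw [kktM₁_mulVec, kktRhs] at hz1
  rw [kktM₂_mulVec] at hz2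
  have e1 : ∀ i, x i - t i ≤ 0 := fun i => hz1 (.inl i)
  have e2 : ∀ i, -x i - t i ≤ 0 := fun i => hz1 (.inr (.inl i))
  have e3 : xi ≤ τ := hz1 (.inr (.inr (.inl ())))
  have e4 : ∀ i, (Aᵀ *ᵥ (A *ᵥ x)) i - xi ≤ (Aᵀ *ᵥ y) i := fun i => hz1 (.inr (.inr (.inr (.inl i))))
  have e5 : ∀ i, -(Aᵀ *ᵥ (A *ᵥ x)) i - xi ≤ -(Aᵀ *ᵥ y) i :=
    fun i => hz1 (.inr (.inr (.inr (.inr (.inl i)))))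
  have e8 : ∀ i, w1 i + w2 i ≤ 1 :=
    fun i => hz1 (.inr (.inr (.inr (.inr (.inr (.inr (.inr (.inl i))))))))
  have e9 : -w3 + ∑ i, w4 i + ∑ i, w5 i ≤ 0 :=
    hz1 (.inr (.inr (.inr (.inr (.inr (.inr (.inr (.inr (.inl ())))))))))
  have e10 : ∀ i, w6 i + w7 i ≤ 0 :=
    fun i => hz1 (.inr (.inr (.inr (.inr (.inr (.inr (.inr (.inr (.inr (.inl i))))))))))
  have e11 : ∀ i, -w1 i ≤ 0 :=
    fun i => hz1 (.inr (.inr (.inr (.inr (.inr (.inr (.inr (.inr (.inr (.inr (.inl i)))))))))))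
  have e12 : ∀ i, -w2 i ≤ 0 := fun i =>
    hz1 (.inr (.inr (.inr (.inr (.inr (.inr (.inr (.inr (.inr (.inr (.inr (.inl i))))))))))))
  have e14 : ∀ i, -w4 i ≤ 0 := fun i =>
    hz1 (.inr (.inr (.inr (.inr (.inr (.inr (.inr (.inr (.inr (.inr (.inr (.inr (.inr
      (.inl i))))))))))))))
  have e15 : ∀ i, -w5 i ≤ 0 := fun i =>
    hz1 (.inr (.inr (.inr (.inr (.inr (.inr (.inr (.inr (.inr (.inr (.inr (.inr (.inr (.inr
      (.inl i)))))))))))))))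
  have e16 : ∀ i, -w6 i ≤ 0 := fun i =>
    hz1 (.inr (.inr (.inr (.inr (.inr (.inr (.inr (.inr (.inr (.inr (.inr (.inr (.inr (.inr (.inr
      (.inl i))))))))))))))))
  have e17 : ∀ i, -w7 i ≤ 0 := fun i =>
    hz1 (.inr (.inr (.inr (.inr (.inr (.inr (.inr (.inr (.inr (.inr (.inr (.inr (.inr (.inr (.inr
      (.inr i))))))))))))))))
  have h6 : w6 = 0 := funext fun i => by
    have := e10 i; have := e16 i; have := e17 i
    simp only [Pi.zero_apply]
    linarith
  have h7 : w7 = 0 := funext fun i => by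
    have := e10 i; have := e16 i; have := e17 i
    simp only [Pi.zero_apply]
    linarith
  subst h6 h7
  simp only [sub_zero, add_zero] at hz2
  have f1 : ∀ i, (Aᵀ *ᵥ (A *ᵥ (w4 - w5))) i = w1 i - w2 i := fun i => by
    have := congrFun hz2 (.inl i)
    simp only [Sum.elim_inl, Pi.add_apply, Pi.neg_apply, Pi.zero_apply] at this
    linarith
  have f2 : ∑ i, t i + τ * w3 - y ⬝ᵥ (A *ᵥ (w4 - w5)) = 0 := congrFun hz2 (.inr ())
  have hxz : kktPoint x t xi v w1 w2 w3 w4 w5 0 0 ∘ Sum.inl = x := rfl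
  rw [hxz]
  refine ⟨(dsResidual_le_iff A y x hτ).2 fun i => ?_, fun u hu => ?_⟩
  · have := e4 i; have := e5 i
    rw [abs_le]
    constructor <;> linarith
  · have g1 := le_lpN_one_of_dual hτ (h := w4 - w5) (fun i => by
      have := e11 i; have := e12 i
      rw [f1]
      exact abs_sub_le_one_of_add_le_one (by linarith) (by linarith) (e8 i)) hu
    have g2 : ∑ i, |(w4 - w5) i| ≤ w3 := by
      have : ∑ i, |(w4 - w5) i| ≤ ∑ i, w4 i + ∑ i, w5 i := by
        rw [← Finset.sum_add_distrib]
        refine Finset.sum_le_sum fun i _ => (abs_sub _ _).trans ?_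
        rw [abs_of_nonneg (neg_nonpos.1 (e14 i)), abs_of_nonneg (neg_nonpos.1 (e15 i))]
      linarith
    have g3 : lpN 1 x ≤ ∑ i, t i := by
      rw [lpN_one]
      refine Finset.sum_le_sum fun i _ => ?_
      have := e1 i; have := e2 i
      rw [abs_le]
      constructor <;> linarith
    have g4 := mul_le_mul_of_nonneg_left g2 hτ
    linarith

theorem lpN_two_comp_inl_le {ι κ : Type*} [Fintype ι] [Fintype κ] (z : ι ⊕ κ → ℝ) :
    lpN 2 (z ∘ Sum.inl) ≤ lpN 2 z := by
  rw [lpN_two, lpN_two, Fintype.sum_sum_type]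
  exact Real.sqrt_le_sqrt (le_add_of_nonneg_right (Finset.sum_nonneg fun i _ => sq_nonneg _))

/-- The error bound for the Dantzig selector under the weak range space property. -/
theorem WeakRSP.exists_isOptimal_lpN_two_le {A : Matrix (Fin m) (Fin n) ℝ} {k : ℕ}
    (h : WeakRSP A k) (hA : A.rank = m) (y : Fin m → ℝ) {τ : ℝ} (hτ : 0 ≤ τ) (x : Fin n → ℝ) :
    ∃ x', IsOptimal A y τ x' ∧ lpN 2 (x - x') ≤ gammaDS A y τ *
      (max (dsResidual A y x - τ) 0 + 2 * bestTermError k x + cA A * τ +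
        cA A * dsResidual A y x) := by
  obtain ⟨x₀, hx₀⟩ := exists_isOptimal hA y hτ
  obtain ⟨z₀, hz₀1, hz₀2⟩ := exists_kkt_of_isOptimal hτ hx₀
  obtain ⟨u, hu1, hu2⟩ := h.exists_dual x
  obtain ⟨g, hg, hgc⟩ := exists_preimage_lpN_one_le_cA hA u hu1
  set r := dsResidual A y x with hr
  have hr0 : 0 ≤ r := dsResidual_nonneg A y x
  have hri := (dsResidual_le_iff A y x hr0).1 hr.ge
  set ζ := Aᵀ *ᵥ u with hζ
  -- `ζ` and `g` are split into positive and negative parts. As `Ag = u` and `ζ = Aᵀu`, the vector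
  -- equation holds exactly, and `ξ = r` makes the residual rows hold; only `ξ ≤ τ` and the gap
  -- equation may fail.
  set z : KKTVar n n → ℝ := kktPoint x (fun i => |x i|) r
    (fun i => |(Aᵀ *ᵥ (A *ᵥ x)) i - (Aᵀ *ᵥ y) i|) (fun i => max (ζ i) 0) (fun i => max (-ζ i) 0)
    (∑ i, |g i|) (fun i => max (g i) 0) (fun i => max (-g i) 0) 0 0 with hz
  obtain ⟨p, hp1, hp2, hp3⟩ := exists_dist_le_robinsonSigma _ _ _ _ z z₀ hz₀1 hz₀2
  refine ⟨p ∘ Sum.inl, isOptimal_of_kkt hτ hp1 hp2, ?_⟩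
  have hzp : x - p ∘ Sum.inl = (z - p) ∘ Sum.inl := rfl
  rw [hzp]
  refine (lpN_two_comp_inl_le _).trans (hp3.trans (mul_le_mul_of_nonneg_left ?_
    (robinsonSigma_nonneg _ _)))
  have hsplit : ∀ a : ℝ, max a 0 + max (-a) 0 = |a| := fun a =>
    max_zero_add_max_neg_zero_eq_abs_self a
  have hg4 : (fun i => max (g i) 0) - (fun i => max (-g i) 0) = g :=
    funext fun i => max_zero_sub_max_neg_zero_eq_self (g i)
  have hpos : ∀ a : ℝ, a ≤ 0 → max a 0 = 0 := fun a ha => max_eq_right ha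
  have hI : ∑ i, max ((kktM₁ A A 1 *ᵥ z) i - kktRhs A y τ i) 0 ≤ max (r - τ) 0 := by
    refine (Finset.sum_le_sum (g := fun i => Sum.elim 0 (Sum.elim 0 (Sum.elim
      (fun _ => max (r - τ) 0) 0)) i) fun i _ => ?_).trans (by simp [Fintype.sum_sum_type])
    rw [hz, kktM₁_mulVec, kktRhs]
    rcases i with i | i | i | i | i | i | i | i | i | i | i | i | i | i | i | i | i <;>
      simp only [Sum.elim_inl, Sum.elim_inr, Pi.zero_apply, Pi.neg_apply, Pi.one_apply] <;>
      refine max_le ?_ (by first | exact le_rfl | exact le_max_right _ _)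
    · linarith [le_abs_self (x i)]
    · linarith [neg_le_abs (x i)]
    · exact le_max_left _ _
    · linarith [(abs_le.1 (hri i)).2]
    · linarith [(abs_le.1 (hri i)).1]
    · linarith [le_abs_self ((Aᵀ *ᵥ (A *ᵥ x)) i - (Aᵀ *ᵥ y) i)]
    · linarith [neg_abs_le ((Aᵀ *ᵥ (A *ᵥ x)) i - (Aᵀ *ᵥ y) i)]
    · rw [hsplit]
      linarith [hu1 i]
    · rw [add_assoc, ← Finset.sum_add_distrib]
      simp only [hsplit]
      linarith
    · linarith
    · linarith [le_max_right (ζ i) 0]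
    · linarith [le_max_right (-ζ i) 0]
    · linarith [Finset.sum_nonneg fun i (_ : i ∈ Finset.univ) => abs_nonneg (g i)]
    · linarith [le_max_right (g i) 0]
    · linarith [le_max_right (-g i) 0]
    · linarith
    · linarith
  have hE : ∑ i, |(kktM₂ A A y τ *ᵥ z) i - (0 : KKTEq n → ℝ) i| ≤
      2 * bestTermError k x + cA A * τ + cA A * r := by
    rw [hz, kktM₂_mulVec, Fintype.sum_sum_type]
    simp only [sub_zero, add_zero, hg4, hg, Sum.elim_inl, Sum.elim_inr, Pi.zero_apply, ← hζ,
      Finset.univ_unique, Finset.sum_singleton, Pi.add_apply, Pi.neg_apply]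
    have h0 : ∀ i, -max (ζ i) 0 + max (-ζ i) 0 + ζ i = 0 := fun i => by
      have := max_zero_sub_max_neg_zero_eq_self (ζ i)
      linarith
    simp only [h0, abs_zero, Finset.sum_const_zero, zero_add]
    -- The gap is `(‖x‖₁ - x·ζ) + τ‖g‖₁ + (x·ζ - y·u)`; this identity bounds the last bracket by
    -- `r‖g‖₁`.
    have h1 : (Aᵀ *ᵥ (A *ᵥ x) - Aᵀ *ᵥ y) ⬝ᵥ g = x ⬝ᵥ ζ - y ⬝ᵥ u := by
      rw [dotProduct_comm, dotProduct_sub, dotProduct_transpose_mulVec,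
        dotProduct_transpose_mulVec, hζ, dotProduct_transpose_mulVec, hg, dotProduct_comm u]
    have h2 : |(Aᵀ *ᵥ (A *ᵥ x) - Aᵀ *ᵥ y) ⬝ᵥ g| ≤ r * ∑ i, |g i| := by
      rw [dotProduct_comm]
      exact dotProduct_le_of_abs_le hri
    have h3 : |x ⬝ᵥ ζ| ≤ ∑ i, |x i| := by
      have := dotProduct_le_of_abs_le (a := x) hu1
      rwa [one_mul] at this
    have h4 : r * ∑ i, |g i| ≤ r * cA A := mul_le_mul_of_nonneg_left hgc hr0
    have h5 : τ * ∑ i, |g i| ≤ τ * cA A := mul_le_mul_of_nonneg_left hgc hτ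
    have h6 : 0 ≤ τ * ∑ i, |g i| :=
      mul_nonneg hτ (Finset.sum_nonneg fun i _ => abs_nonneg _)
    rw [h1] at h2
    have h7 := abs_le.1 h2
    have h8 := abs_le.1 h3
    have h9 := bestTermError_nonneg k x
    rw [abs_le]
    constructor <;> nlinarith
  linarith

theorem WeakRSP.exists_errorEstimate {A : Matrix (Fin m) (Fin n) ℝ} {k : ℕ}
    (h : WeakRSP A k) (hA : A.rank = m) (y : Fin m → ℝ) {τ : ℝ} (hτ : 0 ≤ τ) {x : Fin n → ℝ}
    (hx : dsResidual A y x ≤ τ) :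
    ∃ x', IsOptimal A y τ x' ∧ ErrorEstimate A k y τ x x' := by
  obtain ⟨x', h1, h2⟩ := h.exists_isOptimal_lpN_two_le hA y hτ x
  rw [max_eq_right (sub_nonpos.2 hx), zero_add] at h2
  refine ⟨x', h1, h2, ?_⟩
  have h3 := mul_le_mul_of_nonneg_left (mul_le_mul_of_nonneg_left hx (cA_nonneg A))
    (show 0 ≤ gammaDS A y τ from robinsonSigma_nonneg _ _)
  linarith

end KKT

/-! ### Matrix conditions implying the weak range space property -/

/-- The non-strict null space property implies the weak range space property. -/
theorem weakRSP_of_nullSpace {A : Matrix (Fin m) (Fin n) ℝ} (hA : A.rank = m) {k : ℕ}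
    (h : ∀ z : Fin n → ℝ, A *ᵥ z = 0 → ∀ S : Finset (Fin n), S.card ≤ k →
      ∑ i ∈ S, |z i| ≤ ∑ i ∈ Sᶜ, |z i|) : WeakRSP A k := by
  refine weakRSP_of_isOptimal fun S₁ S₂ hS hk =>
    ⟨(dsResidual_eq_zero_iff hA _ _).2 rfl, fun z hz => ?_⟩
  rw [dsResidual_eq_zero_iff hA] at hz
  set s := signVec S₁ S₂ with hs
  -- For a competitor `z`, the kernel vector `z - s` agrees with `z` off the support of `s`; its
  -- mass there pays for whatever `z` saves on the support.
  have h1 := h (z - s) (by rw [Matrix.mulVec_sub, hz, sub_self]) (S₁ ∪ S₂)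
    ((Finset.card_union_le _ _).trans hk)
  have h2 : ∀ i ∈ (S₁ ∪ S₂)ᶜ, s i = 0 := by
    intro i hi
    simp only [Finset.mem_compl, Finset.mem_union, not_or] at hi
    simp [hs, signVec, hi]
  rw [lpN_one, lpN_one, ← Finset.sum_add_sum_compl (S₁ ∪ S₂),
    ← Finset.sum_add_sum_compl (S₁ ∪ S₂) (fun i => |z i|)]
  have h3 : ∑ i ∈ (S₁ ∪ S₂)ᶜ, |s i| = 0 := Finset.sum_eq_zero fun i hi => by simp [h2 i hi]
  have h4 : ∑ i ∈ (S₁ ∪ S₂)ᶜ, |z i| = ∑ i ∈ (S₁ ∪ S₂)ᶜ, |(z - s) i| :=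
    Finset.sum_congr rfl fun i hi => by simp [h2 i hi]
  have h5 : ∑ i ∈ S₁ ∪ S₂, |s i| ≤ ∑ i ∈ S₁ ∪ S₂, |z i| + ∑ i ∈ S₁ ∪ S₂, |(z - s) i| := by
    rw [← Finset.sum_add_distrib]
    refine Finset.sum_le_sum fun i _ => ?_
    have := abs_sub (z i) (z i - s i)
    rwa [sub_sub_cancel] at this
  linarith

theorem sum_le_coherence (A : Matrix (Fin m) (Fin n) ℝ) {s : ℕ} {i : Fin n} {S : Finset (Fin n)}
    (hi : i ∉ S) (hS : S.card ≤ s) : ∑ j ∈ S, |A.col i ⬝ᵥ A.col j| ≤ coherence A s := by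
  refine le_csSup (Set.Finite.bddAbove ((Set.finite_range
    (fun p : Fin n × Finset (Fin n) => ∑ j ∈ p.2, |A.col p.1 ⬝ᵥ A.col j|)).subset ?_))
    ⟨i, S, hi, hS, rfl⟩
  rintro _ ⟨i, S, -, -, rfl⟩
  exact ⟨(i, S), rfl⟩

theorem coherence_nonneg (A : Matrix (Fin m) (Fin n) ℝ) (s : ℕ) : 0 ≤ coherence A s := by
  refine Real.sSup_nonneg ?_
  rintro _ ⟨i, S, -, -, rfl⟩
  exact Finset.sum_nonneg fun _ _ => abs_nonneg _

/-- Row `i` of `AᵀAz = 0` expresses `z i` through the other entries, as the columns are normalized.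
Summing over `S` and exchanging sums gives `‖z_S‖₁ ≤ μ₁(k-1)‖z_S‖₁ + μ₁(k)‖z_Sᶜ‖₁`. For `k = 0` the
truncated `k - 1` is harmless, since `S` is empty. -/
theorem CoherenceCondition.sum_le {A : Matrix (Fin m) (Fin n) ℝ} {k : ℕ}
    (h : CoherenceCondition A k) (z : Fin n → ℝ) (hz : A *ᵥ z = 0) (S : Finset (Fin n))
    (hS : S.card ≤ k) : ∑ i ∈ S, |z i| ≤ ∑ i ∈ Sᶜ, |z i| := by
  obtain ⟨hnorm, hμ⟩ := h
  set c : Fin n → Fin n → ℝ := fun i j => |A.col i ⬝ᵥ A.col j| with hc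
  have hcs : ∀ i j, c i j = c j i := fun i j => by simp only [hc, dotProduct_comm]
  have hzi : ∀ i ∈ S, |z i| ≤ ∑ j ∈ S.erase i, |z j| * c i j + ∑ j ∈ Sᶜ, |z j| * c i j := by
    intro i hi
    have h1 : ∑ j, z j * (A.col i ⬝ᵥ A.col j) = 0 := by
      have := congrArg (fun w => A.col i ⬝ᵥ w) hz
      simpa [mulVec_eq_sum_col, dotProduct_sum, dotProduct_smul] using this
    rw [← Finset.sum_add_sum_compl S, ← Finset.add_sum_erase S _ hi, ← lpN_two_sq, hnorm i,
      one_pow, mul_one] at h1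
    have h2 : z i = -(∑ j ∈ S.erase i, z j * (A.col i ⬝ᵥ A.col j) +
      ∑ j ∈ Sᶜ, z j * (A.col i ⬝ᵥ A.col j)) := by linarith
    rw [h2, abs_neg]
    refine (abs_add_le _ _).trans (add_le_add ?_ ?_) <;>
    · refine (Finset.abs_sum_le_sum_abs _ _).trans (Finset.sum_le_sum fun j _ => ?_)
      rw [abs_mul]
  have hsum := Finset.sum_le_sum hzi
  rw [Finset.sum_add_distrib] at hsum
  have hin : ∑ i ∈ S, ∑ j ∈ S.erase i, |z j| * c i j ≤ coherence A (k - 1) * ∑ i ∈ S, |z i| := by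
    rw [Finset.sum_comm' (t' := S) (s' := fun j => S.erase j) (by
      intro i j
      simp only [Finset.mem_erase]
      tauto), Finset.mul_sum]
    refine Finset.sum_le_sum fun j hj => ?_
    rw [← Finset.mul_sum, mul_comm]
    refine mul_le_mul_of_nonneg_right ?_ (abs_nonneg _)
    simp only [hcs _ j]
    refine sum_le_coherence A (Finset.notMem_erase j S) ?_
    rw [Finset.card_erase_of_mem hj]
    exact Nat.sub_le_sub_right hS 1
  have hout : ∑ i ∈ S, ∑ j ∈ Sᶜ, |z j| * c i j ≤ coherence A k * ∑ i ∈ Sᶜ, |z i| := by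
    rw [Finset.sum_comm, Finset.mul_sum]
    refine Finset.sum_le_sum fun j hj => ?_
    rw [← Finset.mul_sum, mul_comm]
    refine mul_le_mul_of_nonneg_right ?_ (abs_nonneg _)
    simp only [hcs _ j]
    exact sum_le_coherence A (Finset.mem_compl.1 hj) hS
  have hk := coherence_nonneg A k
  have hY : 0 ≤ ∑ i ∈ Sᶜ, |z i| := Finset.sum_nonneg fun i _ => abs_nonneg _
  refine le_of_mul_le_mul_left (a := 1 - coherence A (k - 1)) ?_ (by linarith)
  have := mul_le_mul_of_nonneg_right (show coherence A k ≤ 1 - coherence A (k - 1) by linarith) hY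
  linarith

/-! ### Restricted isometry below `1/√2` -/

/-- A linear functional on the polytope `0 ≤ p ≤ 1`, `∑ p ≤ k` is bounded by its value at the
indicator of a set of at most `k` elements. -/
theorem exists_sum_mul_le_sum {ι : Type*} [DecidableEq ι] (R : Finset ι) (g p : ι → ℝ) (k : ℕ)
    (h0 : ∀ i ∈ R, 0 ≤ p i) (h1 : ∀ i ∈ R, p i ≤ 1) (hk : ∑ i ∈ R, p i ≤ k) :
    ∃ T ⊆ R, T.card ≤ k ∧ ∑ i ∈ R, g i * p i ≤ ∑ i ∈ T, g i := by
  obtain ⟨T, hT, hmax⟩ := Finset.exists_max_image (R.powerset.filter fun T => T.card ≤ k)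
    (fun T => ∑ i ∈ T, g i) ⟨∅, by simp⟩
  simp only [Finset.mem_filter, Finset.mem_powerset, and_imp] at hT hmax
  obtain ⟨hTR, hTk⟩ := hT
  refine ⟨T, hTR, hTk, ?_⟩
  have hgT : ∀ i ∈ T, 0 ≤ g i := by
    intro i hi
    have h2 := hmax (T.erase i) ((Finset.erase_subset i T).trans hTR)
      ((Finset.card_le_card (Finset.erase_subset i T)).trans hTk)
    rw [← Finset.add_sum_erase T g hi] at h2
    linarith
  -- `θ` is a threshold between the values of `g` on `T` and off `T`: the least value on `T` when
  -- `T` has `k > 0` elements, and 0 otherwise.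
  obtain ⟨θ, hθ0, hθT, hθR, hθ⟩ : ∃ θ : ℝ, 0 ≤ θ ∧ (∀ i ∈ T, θ ≤ g i) ∧
      (∀ i ∈ R \ T, g i * p i ≤ θ * p i) ∧ θ * ∑ i ∈ R, p i ≤ θ * T.card := by
    rcases hTk.lt_or_eq with hlt | heq
    · refine ⟨0, le_rfl, hgT, fun i hi => ?_, by simp⟩
      obtain ⟨hiR, hiT⟩ := Finset.mem_sdiff.1 hi
      have h2 := hmax (insert i T) (Finset.insert_subset hiR hTR)
        ((Finset.card_insert_le _ _).trans hlt)
      rw [Finset.sum_insert hiT] at h2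
      exact mul_le_mul_of_nonneg_right (by linarith) (h0 i hiR)
    · rcases T.eq_empty_or_nonempty with rfl | hne
      · have hk0 : k = 0 := by simpa using heq.symm
        rw [hk0, Nat.cast_zero] at hk
        have hp := (Finset.sum_eq_zero_iff_of_nonneg h0).1 (le_antisymm hk (Finset.sum_nonneg h0))
        exact ⟨0, le_rfl, hgT, fun i hi => by simp [hp i (Finset.mem_sdiff.1 hi).1], by simp⟩
      · obtain ⟨j, hj, hjmin⟩ := Finset.exists_min_image T g hne
        refine ⟨g j, hgT j hj, hjmin, fun i hi => ?_, ?_⟩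
        · obtain ⟨hiR, hiT⟩ := Finset.mem_sdiff.1 hi
          have hie : i ∉ T.erase j := fun h => hiT (Finset.mem_of_mem_erase h)
          have h2 := hmax (insert i (T.erase j))
            (Finset.insert_subset hiR ((Finset.erase_subset j T).trans hTR)) (by
              rw [Finset.card_insert_of_notMem hie, Finset.card_erase_add_one hj]
              exact hTk)
          rw [Finset.sum_insert hie, ← Finset.add_sum_erase T g hj] at h2
          exact mul_le_mul_of_nonneg_right (by linarith) (h0 i hiR)
        · rw [heq]
          exact mul_le_mul_of_nonneg_left hk (hgT j hj)
  have h2 := Finset.sum_le_sum hθR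
  have h3 : ∑ i ∈ T, θ * (1 - p i) ≤ ∑ i ∈ T, g i * (1 - p i) := Finset.sum_le_sum fun i hi =>
    mul_le_mul_of_nonneg_right (hθT i hi) (sub_nonneg.2 (h1 i (hTR hi)))
  simp only [mul_sub, mul_one, Finset.sum_sub_distrib, Finset.sum_const, nsmul_eq_mul,
    ← Finset.mul_sum] at h2 h3
  rw [← Finset.sum_sdiff hTR] at hθ ⊢
  linarith

theorem hammingNorm_le_of_support {v : Fin n → ℝ} {S T : Finset (Fin n)} {k : ℕ}
    (hS : S.card ≤ k) (hT : T.card ≤ k) (hv : ∀ i, i ∉ S → i ∉ T → v i = 0) :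
    hammingNorm v ≤ 2 * k := by
  have h1 : (Finset.univ.filter fun i => v i ≠ 0) ⊆ S ∪ T := by
    intro i hi
    simp only [Finset.mem_filter, Finset.mem_univ, true_and] at hi
    by_contra h
    simp only [Finset.mem_union, not_or] at h
    exact hi (hv i h.1 h.2)
  have h2 := (Finset.card_le_card h1).trans (Finset.card_union_le _ _)
  exact h2.trans (by omega)

/-- The quadratic inequality behind the threshold `δ < 1/√2`, with `s = √2`. -/
theorem rip_quadratic_false {s δ P Q X U V : ℝ} (hs2 : s ^ 2 = 2) (hs1 : 1 < s) (hs3 : s < 3 / 2)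
    (hδ0 : 0 < δ) (hδ : 2 * δ < s) (hX : 0 < X) (hU : U ≤ X) (hPQ : P + Q ≤ 0)
    (h1 : (3 / 2 - s) ^ 2 * P - (3 / 2 - s) * (s - 1) * Q + (s - 1) ^ 2 / 4 * V ≤
      (1 + δ) * ((3 / 2 - s) ^ 2 * X + (s - 1) ^ 2 / 4 * U))
    (h2 : (1 - δ) * (X + (s - 1) ^ 2 * U) ≤ P + 2 * (s - 1) * Q + (s - 1) ^ 2 * V) : False := by
  -- Four times `h1` added to `h2` cancels `V` and gives `P` and `Q` the same coefficient `4(3s - 4)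
  -- > 0`, so `P + Q ≤ 0` can be used. With `U ≤ X`, what remains is `4X(s - 2δ)(3 - 2s) ≤ 0`,
  -- contradicting `δ < s/2`.
  have e1 : (3 / 2 - s) ^ 2 = 17 / 4 - 3 * s := by linear_combination hs2
  have e2 : (s - 1) ^ 2 = 3 - 2 * s := by linear_combination hs2
  have e3 : (3 / 2 - s) * (s - 1) = 5 / 2 * s - 7 / 2 := by linear_combination -hs2
  rw [e1, e2, e3] at h1
  rw [e2] at h2
  have h3 : 0 ≤ (3 * s - 4) * -(P + Q) := mul_nonneg (by nlinarith) (by linarith)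
  have h4 : 0 ≤ (δ * (3 / 2 - s)) * (X - U) :=
    mul_nonneg (mul_nonneg hδ0.le (by linarith)) (by linarith)
  have h5 : 0 < (s - 2 * δ) * (3 - 2 * s) := mul_pos (by linarith) (by linarith)
  have h6 : (s - 2 * δ) * (3 - 2 * s) = 3 * s - 4 - δ * (6 - 4 * s) := by
    linear_combination -2 * hs2
  rw [h6] at h5
  have h7 := mul_pos hX h5
  linarith

/-- The theorem of Cai and Zhang: a restricted isometry constant `δ_{2k} < 1/√2` implies the null
space property. -/
theorem RIP.sum_le {A : Matrix (Fin m) (Fin n) ℝ} {k : ℕ} {δ : ℝ} (hδ0 : 0 < δ)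
    (hδ : δ < 1 / √2) (h : RIP A (2 * k) δ) (z : Fin n → ℝ) (hz : A *ᵥ z = 0)
    (S' : Finset (Fin n)) (hS' : S'.card ≤ k) : ∑ i ∈ S', |z i| ≤ ∑ i ∈ S'ᶜ, |z i| := by
  obtain ⟨S, hSk, hmax⟩ := Finset.exists_max_image
    (Finset.univ.filter fun S : Finset (Fin n) => S.card ≤ k) (fun S => ∑ i ∈ S, |z i|)
    ⟨∅, by simp⟩
  simp only [Finset.mem_filter, Finset.mem_univ, true_and] at hSk hmax
  suffices hmain : ∑ i ∈ S, |z i| ≤ ∑ i ∈ Sᶜ, |z i| by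
    have h1 := hmax S' hS'
    have h2 := Finset.sum_add_sum_compl S fun i => |z i|
    have h3 := Finset.sum_add_sum_compl S' fun i => |z i|
    linarith
  by_contra! hlt
  set N := ∑ i ∈ S, |z i| with hN
  have hNpos : 0 < N := (Finset.sum_nonneg fun i _ => abs_nonneg _).trans_lt hlt
  have hkpos : 0 < k := by
    rcases Nat.eq_zero_or_pos k with rfl | hk
    · have : S = ∅ := by simpa using hSk
      simp [hN, this] at hNpos
    · exact hk
  have hk0 : (0 : ℝ) < k := by exact_mod_cast hkpos
  -- Off `S`, maximality bounds every entry of `z` by this quotient: by the average over `S` if `S`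
  -- has `k` elements, and by 0 if it has fewer.
  set α := N / k with hα
  have hαpos : 0 < α := div_pos hNpos hk0
  have hkα : k * α = N := by rw [hα]; field_simp
  have hzα : ∀ j ∈ Sᶜ, |z j| ≤ α := by
    intro j hj
    have hjS : j ∉ S := Finset.mem_compl.1 hj
    rcases hSk.lt_or_eq with hlt' | heq
    · have h2 := hmax (insert j S) ((Finset.card_insert_le _ _).trans hlt')
      rw [Finset.sum_insert hjS] at h2
      linarith
    · rw [hα, le_div_iff₀ hk0, mul_comm, ← heq, ← nsmul_eq_mul]
      refine Finset.card_nsmul_le_sum _ _ _ fun i hi => ?_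
      have hje : j ∉ S.erase i := fun h => hjS (Finset.mem_of_mem_erase h)
      have h2 := hmax (insert j (S.erase i)) (by
        rw [Finset.card_insert_of_notMem hje, Finset.card_erase_add_one hi]
        exact hSk)
      rw [Finset.sum_insert hje, hN, ← Finset.add_sum_erase S _ hi] at h2
      linarith
  set a : Fin n → ℝ := fun i => if i ∈ S then z i else 0 with ha
  set f : Fin n → ℝ := Aᵀ *ᵥ (A *ᵥ a) with hf
  -- The tail of `z` is `α` times signs times weights in `[0,1]` with sum at most `k`. A vertex of
  -- this polytope replaces it by a `k`-sparse `u` with `f·u ≤ f·z_Sᶜ`; since `f·z = 0`, this yields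
  -- `⟨Aa, Aa⟩ + ⟨Aa, Au⟩ ≤ 0`.
  obtain ⟨T, hTS, hTk, hT⟩ := exists_sum_mul_le_sum Sᶜ (fun i => -(α * SignType.sign (z i) * f i))
    (fun i => |z i| / α) k (fun i _ => by positivity)
    (fun i hi => (div_le_one hαpos).2 (hzα i hi)) (by
      rw [← Finset.sum_div, div_le_iff₀ hαpos, hkα]
      exact hlt.le)
  set u : Fin n → ℝ := fun i => if i ∈ T then α * SignType.sign (z i) else 0 with hu
  have hST : ∀ i ∈ T, i ∉ S := fun i hi => Finset.mem_compl.1 (hTS hi)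
  have hfu : f ⬝ᵥ u = ∑ i ∈ T, α * SignType.sign (z i) * f i := by
    simp [dotProduct, hu, mul_comm]
  have hfz : f ⬝ᵥ z = 0 := by
    rw [dotProduct_comm, hf, dotProduct_transpose_mulVec, hz, dotProduct_zero]
  have hfa : f ⬝ᵥ a = (A *ᵥ a) ⬝ᵥ (A *ᵥ a) := by
    rw [dotProduct_comm, hf, dotProduct_transpose_mulVec]
  have hfS : f ⬝ᵥ z = f ⬝ᵥ a + ∑ i ∈ Sᶜ, f i * z i := by
    rw [dotProduct, ← Finset.sum_add_sum_compl S]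
    simp [dotProduct, ha]
  have hT' : ∑ i ∈ Sᶜ, -(α * SignType.sign (z i) * f i) * (|z i| / α) =
      -∑ i ∈ Sᶜ, f i * z i := by
    rw [← Finset.sum_neg_distrib]
    refine Finset.sum_congr rfl fun i _ => ?_
    have h2 := sign_mul_abs (z i)
    calc -(α * SignType.sign (z i) * f i) * (|z i| / α)
        = -(f i * (SignType.sign (z i) * |z i|)) := by field_simp
      _ = -(f i * z i) := by rw [h2]
  rw [hT', Finset.sum_neg_distrib, ← hfu] at hT
  have hPQ : (A *ᵥ a) ⬝ᵥ (A *ᵥ a) + (A *ᵥ a) ⬝ᵥ (A *ᵥ u) ≤ 0 := by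
    have : f ⬝ᵥ u = (A *ᵥ a) ⬝ᵥ (A *ᵥ u) := by
      rw [dotProduct_comm, hf, dotProduct_transpose_mulVec]
    linarith
  have hau : a ⬝ᵥ u = 0 := by
    refine Finset.sum_eq_zero fun i _ => ?_
    by_cases hi : i ∈ T
    · simp [ha, hST i hi]
    · simp [hu, hi]
  have haa : a ⬝ᵥ a = ∑ i ∈ S, z i ^ 2 := by
    simp [dotProduct, ha, sq]
  have hX : k * α ^ 2 ≤ a ⬝ᵥ a := by
    have h2 := sq_sum_le_card_mul_sum_sq (s := S) (f := fun i => |z i|)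
    simp only [sq_abs] at h2
    rw [← haa, ← hN, ← hkα] at h2
    have h3 : (S.card : ℝ) * (a ⬝ᵥ a) ≤ k * (a ⬝ᵥ a) := by
      refine mul_le_mul_of_nonneg_right (by exact_mod_cast hSk) ?_
      rw [haa]
      exact Finset.sum_nonneg fun i _ => sq_nonneg _
    refine le_of_mul_le_mul_left (a := (k : ℝ)) ?_ hk0
    linarith
  have hU : u ⬝ᵥ u ≤ a ⬝ᵥ a := by
    refine le_trans ?_ hX
    have h2 : u ⬝ᵥ u = ∑ i ∈ T, (α * SignType.sign (z i)) ^ 2 := by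
      simp [dotProduct, hu, sq]
    rw [h2]
    have h3 : ∑ i ∈ T, (α * (SignType.sign (z i) : ℝ)) ^ 2 ≤ ∑ i ∈ T, α ^ 2 := by
      refine Finset.sum_le_sum fun i _ => ?_
      rw [mul_pow]
      refine mul_le_of_le_one_right (sq_nonneg _) ?_
      rcases lt_trichotomy (z i) 0 with h | h | h <;> simp [h]
    refine h3.trans ?_
    rw [Finset.sum_const, nsmul_eq_mul]
    exact mul_le_mul_of_nonneg_right (by exact_mod_cast hTk) (sq_nonneg _)
  have hXpos : 0 < a ⬝ᵥ a := lt_of_lt_of_le (by positivity) hX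
  have hs2 : √2 ^ 2 = (2 : ℝ) := Real.sq_sqrt zero_le_two
  have hs1 : 1 < √2 := Real.lt_sqrt_of_sq_lt (by norm_num)
  have hs3 : √2 < 3 / 2 := (Real.sqrt_lt' (by norm_num)).2 (by norm_num)
  have hδ' : 2 * δ < √2 := by
    rw [lt_div_iff₀ (by positivity)] at hδ
    nlinarith
  -- Both test vectors are `2k`-sparse, and `a ⬝ᵥ u = 0`; the weights are those that make
  -- `rip_quadratic_false` work.
  have hr1 := (h ((3 / 2 - √2) • a - ((√2 - 1) / 2) • u)
    (hammingNorm_le_of_support hSk hTk fun i h1 h2 => by simp [ha, hu, h1, h2])).2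
  have hr2 := (h (a + (√2 - 1) • u)
    (hammingNorm_le_of_support hSk hTk fun i h1 h2 => by simp [ha, hu, h1, h2])).1
  have hua : u ⬝ᵥ a = 0 := by rw [dotProduct_comm, hau]
  simp only [lpN_two_sq, Matrix.mulVec_sub, Matrix.mulVec_add, Matrix.mulVec_smul, dotProduct_add,
    dotProduct_sub, add_dotProduct, sub_dotProduct, dotProduct_smul, smul_dotProduct, smul_eq_mul,
    hau, hua, dotProduct_comm (A *ᵥ u) (A *ᵥ a)] at hr1 hr2
  exact rip_quadratic_false (V := (A *ᵥ u) ⬝ᵥ (A *ᵥ u)) hs2 hs1 hs3 hδ0 hδ' hXpos hU hPQ (by linarith) (by linarith)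

theorem weakRSP_of_conditions {A : Matrix (Fin m) (Fin n) ℝ} (hA : A.rank = m) {k : ℕ}
    (h : CoherenceCondition A k ∨
      (∃ δ : ℝ, 0 < δ ∧ δ < 1 / √2 ∧ RIP A (2 * k) δ) ∨
      (∃ ρ : ℝ, 0 < ρ ∧ ρ < 1 ∧ StableNSP A k ρ) ∨
      (∃ ρ' ρ'' : ℝ, 0 < ρ' ∧ ρ' < 1 ∧ 0 < ρ'' ∧ RobustNSP A k ρ' ρ'') ∨
      NSP A k ∨ RSP A k) : WeakRSP A k := by
  have hnn : ∀ (z : Fin n → ℝ) (S : Finset (Fin n)), 0 ≤ ∑ i ∈ Sᶜ, |z i| := fun z S =>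
    Finset.sum_nonneg fun i _ => abs_nonneg _
  rcases h with h | ⟨δ, h0, h1, h⟩ | ⟨ρ, -, h1, h⟩ | ⟨ρ', ρ'', -, h1, -, h⟩ | h | h
  · exact weakRSP_of_nullSpace hA h.sum_le
  · exact weakRSP_of_nullSpace hA (h.sum_le h0 h1)
  · exact weakRSP_of_nullSpace hA fun z hz S hS =>
      (h z hz S hS).trans (mul_le_of_le_one_left (hnn z S) h1.le)
  · refine weakRSP_of_nullSpace hA fun z hz S hS => ?_
    have := h z S hS
    rw [hz, show lpN 2 (0 : Fin m → ℝ) = 0 by simp [lpN], mul_zero, add_zero] at this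
    exact this.trans (mul_le_of_le_one_left (hnn z S) h1.le)
  · refine weakRSP_of_nullSpace hA fun z hz S hS => ?_
    by_cases hz0 : z = 0
    · simp [hz0]
    · exact (h z hz0 hz S hS).le
  · intro S₁ S₂ hS hk
    obtain ⟨u, h1, h2, h3⟩ := h S₁ S₂ hS hk
    exact ⟨u, h1, h2, fun i hi => (h3 i hi).le⟩

/-! ### Necessity of the weak range space property, and the conclusion -/

theorem bestTermError_eq_zero {k : ℕ} {x : Fin n → ℝ} (hx : hammingNorm x ≤ k) :
    bestTermError k x = 0 := by
  refine le_antisymm (csInf_le ⟨0, ?_⟩ ⟨x, hx, by simp [lpN]⟩) (bestTermError_nonneg k x)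
  rintro _ ⟨u, -, rfl⟩
  exact norm_nonneg _

/-- The error estimate for exact data (`τ = 0`) forces the weak range space property. -/
theorem weakRSP_of_errorEstimate {A : Matrix (Fin m) (Fin n) ℝ} (hA : A.rank = m) {k : ℕ}
    (h : ∀ x : Fin n → ℝ, ∃ x', IsOptimal A (A *ᵥ x) 0 x' ∧ ErrorEstimate A k (A *ᵥ x) 0 x x') :
    WeakRSP A k := by
  refine weakRSP_of_isOptimal fun S₁ S₂ _ hk => ?_
  obtain ⟨x', h1, h2, -⟩ := h (signVec S₁ S₂)
  have hs : hammingNorm (signVec S₁ S₂) ≤ k := by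
    refine (Finset.card_le_card (t := S₁ ∪ S₂) fun i hi => ?_).trans
      ((Finset.card_union_le _ _).trans hk)
    simp only [Finset.mem_filter, Finset.mem_univ, true_and] at hi
    by_contra hn
    simp only [Finset.mem_union, not_or] at hn
    exact hi (by simp [signVec, hn])
  have hr : dsResidual A (A *ᵥ signVec S₁ S₂) (signVec S₁ S₂) = 0 :=
    le_antisymm ((dsResidual_eq_zero_iff hA _ _).2 rfl) (dsResidual_nonneg _ _ _)
  rw [bestTermError_eq_zero hs, hr] at h2
  simp only [mul_zero, add_zero] at h2
  -- The bound is `γ · 0`, whatever the value of `γ`, so the optimal `x'` coincides with the sign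
  -- vector.
  rwa [← sub_eq_zero.1 (lpN_two_eq_zero h2)] at h1

end Dantzig

theorem corollary3p4 {m n : ℕ} (A : Matrix (Fin m) (Fin n) ℝ) (hA : A.rank = m) (hmn : m < n)
    (k : ℕ) :
    -- (i), sufficiency
    (Dantzig.WeakRSP A k → ∀ (y : Fin m → ℝ) (τ : ℝ), 0 ≤ τ →
      (∀ x : Fin n → ℝ, ∃ x' : Fin n → ℝ, Dantzig.IsOptimal A y τ x' ∧
        Dantzig.lpN 2 (x - x') ≤ Dantzig.gammaDS A y τ *
          (max (Dantzig.dsResidual A y x - τ) 0 + 2 * Dantzig.bestTermError k x +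
            Dantzig.cA A * τ + Dantzig.cA A * Dantzig.dsResidual A y x)) ∧
      (∀ x : Fin n → ℝ, Dantzig.dsResidual A y x ≤ τ →
        ∃ x' : Fin n → ℝ, Dantzig.IsOptimal A y τ x' ∧ Dantzig.ErrorEstimate A k y τ x x')) ∧
    -- (i), necessity
    ((∀ y : Fin m → ℝ, ∃ τ₀ : ℝ, 0 < τ₀ ∧ ∀ τ : ℝ, 0 ≤ τ → τ ≤ τ₀ →
        ∀ x : Fin n → ℝ, Dantzig.dsResidual A y x ≤ τ →
          ∃ x' : Fin n → ℝ, Dantzig.IsOptimal A y τ x' ∧ Dantzig.ErrorEstimate A k y τ x x') →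
      Dantzig.WeakRSP A k) ∧
    -- (ii)
    ((Dantzig.CoherenceCondition A k ∨
        (∃ δ : ℝ, 0 < δ ∧ δ < 1 / √2 ∧ Dantzig.RIP A (2 * k) δ) ∨
        (∃ ρ : ℝ, 0 < ρ ∧ ρ < 1 ∧ Dantzig.StableNSP A k ρ) ∨
        (∃ ρ' ρ'' : ℝ, 0 < ρ' ∧ ρ' < 1 ∧ 0 < ρ'' ∧ Dantzig.RobustNSP A k ρ' ρ'') ∨
        Dantzig.NSP A k ∨
        Dantzig.RSP A k) →
      ∀ (y : Fin m → ℝ) (τ : ℝ), 0 ≤ τ → ∀ x : Fin n → ℝ, Dantzig.dsResidual A y x ≤ τ →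
        ∃ x' : Fin n → ℝ, Dantzig.IsOptimal A y τ x' ∧ Dantzig.ErrorEstimate A k y τ x x') := by
  refine ⟨fun h y τ hτ => ⟨h.exists_isOptimal_lpN_two_le hA y hτ,
    fun x hx => h.exists_errorEstimate hA y hτ hx⟩, fun h => ?_,
    fun h y τ hτ x hx => (Dantzig.weakRSP_of_conditions hA h).exists_errorEstimate hA y hτ hx⟩
  refine Dantzig.weakRSP_of_errorEstimate hA fun x => ?_
  obtain ⟨τ₀, hτ₀, h0⟩ := h (A *ᵥ x)
  exact h0 0 le_rfl hτ₀.le x ((Dantzig.dsResidual_eq_zero_iff hA _ _).2 rfl)
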